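/- Identify $\mathbb R^2$ with the Euclidean plane, write $B_\rho$ for the open disc of radius $\rho$ centred at $0$, and $\mathcal H^1$ for the one-dimensional Hausdorff measure. (a) For every $0<r<2$ the Dirichlet problem $$-\Delta h_1+h_1=0 \text{ in } B_2\setminus\overline{B_r},\qquad h_1=0\text{ on }\partial B_r,\qquad h_1=1\text{ on }\partial B_2,$$ and for every $R>2$ the Dirichlet problem $$-\Delta h_2+h_2=0 \text{ in } B_R\setminus\overline{B_2},\qquad h_2=1\text{ on }\partial B_2,\qquad h_2=0\text{ on }\partial B_R,$$ has exactly one classical solution ($C^2$ in the open annulus and continuous on the closed annulus), and this solution is radially symmetric. (b) There exist radii $0<r<2<R$ and a number $d>0$ such that, for the solutions $h_1,h_2$ of these problems, $$\partial_\rho h_1(2)=d=-\partial_\rho h_2(2)$$ (one-sided radial derivatives on the circle $\rho=2$). With $\Omega:=B_R\setminus\overline{B_r}$, which is a bounded domain with smooth boundary and is not star-shaped with respect to any point, define $h:=h_1$ on $\overline{B_2}\setminus \overline{B_r}$ and $h:=h_2$ on $B_R\setminus\overline{B_2}$ (extended to $\partial\Omega$ by the boundary values). Then $h\in H^1(\Omega)$,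 $h$ is not a.e. zero, and $h=0$ on $\partial\Omega$, both pointwise ($h$ is continuous on $\overline\Omega$) and in the sense that $h\in H^1_0(\Omega)$; moreover, in the sense of distributions in $\Omega$, $$-\Delta h+h=\mu,\qquad \mu=2d\,\mathcal H^1\llcorner\{\rho=2\}=2\,\partial_\rho h_1(2)\,\mathcal H^1\llcorner\{\rho=2\},\tag{1}$$ $$\sum_{i=1}^2\partial_i\left[2\,\partial_ih\,\partial_jh-\left(|\nabla h|^2+h^2\right)\delta_{ij}\right]=0\qquad (j=1,2),\tag{2}$$ and $\mu$ is a nonzero finite measure. (c) Consequently the hypothesis of star-shapedness cannot be dropped in the following theorem: if $\Omega\subset\mathbb R^2$ is a smooth, bounded, star-shaped domain and $h\in H^1(\Omega)$ satisfies (2) and $h=0$ on $\partial\Omega$, then $h=0$ in $\Omega$. That is, it is not true that for every bounded domain $\Omega\subset\mathbb R^2$ with smooth boundary, every $h\in H^1_0(\Omega)$ satisfying (2) vanishes a.e. in $\Omega$. -/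

import Mathlib

open scoped Distributions Gradient Laplacian MeasureTheory ENNReal ContDiff Topology
open MeasureTheory Filter TopologicalSpace

namespace CircleExample

/-- The Euclidean plane. -/
abbrev Plane : Type := EuclideanSpace ℝ (Fin 2)

/-- The open annulus `B_b(0) \ closure (B_a(0))` (for `0 < a < b`). -/
def annulus (a b : ℝ) : Opens Plane :=
  ⟨Metric.ball 0 b \ Metric.closedBall 0 a, Metric.isOpen_ball.sdiff Metric.isClosed_closedBall⟩

/-- The closed annulus `a ≤ |x| ≤ b`. -/
def closedAnnulus (a b : ℝ) : Set Plane := {x | a ≤ ‖x‖ ∧ ‖x‖ ≤ b}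

/-- `Ω` is a bounded domain (open connected set) with smooth boundary: near each boundary point
`Ω` is the strict sublevel set of a smooth function with nonvanishing differential there. -/
structure IsSmoothBoundedDomain (Ω : Opens Plane) : Prop where
  isBounded : Bornology.IsBounded (Ω : Set Plane)
  isConnected : IsConnected (Ω : Set Plane)
  smooth_boundary : ∀ x ∈ frontier (Ω : Set Plane), ∃ U : Set Plane, IsOpen U ∧ x ∈ U ∧
    ∃ ρ : Plane → ℝ, ContDiff ℝ ∞ ρ ∧ fderiv ℝ ρ x ≠ 0 ∧ ρ x = 0 ∧
      (Ω : Set Plane) ∩ U = {y | ρ y < 0} ∩ U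

/-- `u` is a (classical) solution of `-Δu + u = 0` in `a < |x| < b`, continuous on the closed
annulus, with `u = α` on `|x| = a` and `u = β` on `|x| = b`. -/
structure IsDirichletSolution (a b α β : ℝ) (u : Plane → ℝ) : Prop where
  continuousOn : ContinuousOn u (closedAnnulus a b)
  contDiffOn : ContDiffOn ℝ 2 u (annulus a b)
  equation : ∀ x ∈ annulus a b, -(Δ u) x + u x = 0
  inner_boundary : ∀ x ∈ Metric.sphere (0 : Plane) a, u x = α
  outer_boundary : ∀ x ∈ Metric.sphere (0 : Plane) b, u x = β

/-- `u` is radially symmetric on the set `s`. -/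
def IsRadialOn (s : Set Plane) (u : Plane → ℝ) : Prop :=
  ∀ x ∈ s, ∀ y ∈ s, ‖x‖ = ‖y‖ → u x = u y

/-- `u ∈ H¹(Ω)` with weak gradient `g`. -/
structure IsH1 (Ω : Opens Plane) (u : Plane → ℝ) (g : Plane → Plane) : Prop where
  memLp : MemLp u 2 (volume.restrict Ω)
  memLp_grad : MemLp g 2 (volume.restrict Ω)
  weak_grad : ∀ φ : 𝓓(Ω, ℝ), ∀ i : Fin 2,
    ∫ x in Ω, u x * ∇ φ x i = -∫ x in Ω, g x i * φ x

/-- `u`, with weak gradient `g`, lies in `H¹₀(Ω)`, the closure of the test functions in `H¹(Ω)`;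
this is the condition `u = 0` on `∂Ω` for `u ∈ H¹(Ω)`. -/
structure IsH10 (Ω : Opens Plane) (u : Plane → ℝ) (g : Plane → Plane) : Prop extends
    IsH1 Ω u g where
  approx : ∃ φ : ℕ → 𝓓(Ω, ℝ),
    Tendsto (fun n => eLpNorm (fun x => φ n x - u x) 2 (volume.restrict Ω)) atTop (𝓝 0) ∧
    Tendsto (fun n => eLpNorm (fun x => ∇ (φ n) x - g x) 2 (volume.restrict Ω)) atTop (𝓝 0)

/-- `-Δu + u = μ` in `Ω` in the sense of distributions, for a (nonnegative) measure `μ`. -/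
def SolvesHelmholtz (Ω : Opens Plane) (u : Plane → ℝ) (μ : Measure Plane) : Prop :=
  ∀ φ : 𝓓(Ω, ℝ), ∫ x in Ω, u x * (-(Δ (φ : Plane → ℝ)) x + φ x) = ∫ x in Ω, φ x ∂μ

/-- The stress-energy tensor `T = 2 ∇u ⊗ ∇u - (|∇u|² + u²) I`, where `g = ∇u`. -/
noncomputable def stressTensor (u : Plane → ℝ) (g : Plane → Plane) (x : Plane) :
    Matrix (Fin 2) (Fin 2) ℝ :=
  Matrix.of fun i j => 2 * g x i * g x j - (if i = j then ‖g x‖ ^ 2 + u x ^ 2 else 0)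

/-- `∑ᵢ ∂ᵢ T i j = 0` in `Ω` for `j = 1, 2`, in the sense of distributions. -/
def IsStationary (Ω : Opens Plane) (u : Plane → ℝ) (g : Plane → Plane) : Prop :=
  ∀ φ : 𝓓(Ω, ℝ), ∀ j : Fin 2,
    ∫ x in Ω, ∑ i : Fin 2, stressTensor u g x i j * ∇ φ x i = 0

/-- The function equal to `h₁` for `|x| ≤ 2` and to `h₂` for `|x| > 2`. -/
noncomputable def glue (h₁ h₂ : Plane → ℝ) (x : Plane) : ℝ := if ‖x‖ ≤ 2 then h₁ x else h₂ x

/-- The measure `c · H¹` restricted to the circle `|x| = 2`, for `c ≥ 0`. -/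
noncomputable def circleMeasure (c : ℝ) : Measure Plane :=
  ENNReal.ofReal c • (μH[1]).restrict (Metric.sphere (0 : Plane) 2)

end CircleExample

/-! The stress-energy tensor is quadratic in the gradient, so a kink at which the normal derivative
only changes sign is invisible to it. Where `h` is smooth, `div T = 2 (Δh - h) ∇h`, which vanishes
on each annulus. Across the circle of radius 2 the normal flux of a radial `h` is `(h_ρ² - h²) ν`,
which is continuous when the two slopes are `d` and `-d`. The Helmholtz equation is linear in the
slope and does see the kink: the jump from `d` to `-d` leaves the mass `2d` per unit length.

The profiles come from reduction of order. With `I = I₀ > 0` and `J' = 1/(ρ I²)`, `J(2) = 0`, the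
functions `I (α + β J)` solve `f'' + f'/ρ = f`, and `α, β` can match any two boundary values. The
value at 2 fixes `α`, and the slope at 2 is affine in `β`. A large positive `β` forces a zero just
inside the circle and a large negative one a zero just outside (`nonempty_gluingData`). Uniqueness
for the Dirichlet problems, and hence radial symmetry, is the maximum principle.

Both distributional identities reduce to one integration by parts in the radial variable on each
annulus (`integral_radial_by_parts`), after which only the integral over the middle circle survives.
That integral is compared with Hausdorff measure by showing that the angular parametrization scales
`H¹` by exactly 2 (`hausdorffMeasure_image_circleParam`). Membership in `H¹₀` uses that the glued
profile is the minimum of the two radial solutions: smoothing this minimum from below and truncating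
near zero gives test functions. -/

namespace CircleExample

/-! ### Radial solutions of the Helmholtz equation -/

/-- The entire function `∑ xᵏ / (k! (k + m)!)`, a rescaled modified Bessel function. -/
noncomputable def besselSeries (m : ℕ) (x : ℝ) : ℝ :=
  ∑' k : ℕ, x ^ k / (k.factorial * (k + m).factorial)

lemma summable_besselSeries (m : ℕ) (x : ℝ) :
    Summable fun k : ℕ => x ^ k / ((k.factorial : ℝ) * (k + m).factorial) := by
  refine Summable.of_norm_bounded (Real.summable_pow_div_factorial |x|) fun k => ?_
  rw [norm_div, norm_pow, Real.norm_eq_abs, Real.norm_eq_abs,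
    abs_of_pos (by positivity : (0 : ℝ) < (k.factorial : ℝ) * (k + m).factorial)]
  have h1 : (1 : ℝ) ≤ (k + m).factorial := by exact_mod_cast Nat.factorial_pos _
  have h2 : (0 : ℝ) < k.factorial := by positivity
  gcongr
  nlinarith

/-- The factor `k + 1` brought down by differentiation cancels against `(k + 1)!`. This is why
differentiating the series raises `m` by one. -/
lemma besselSeries_shift (m k : ℕ) (x : ℝ) :
    ((k + 1 : ℕ) : ℝ) * x ^ k / (((k + 1).factorial : ℝ) * (k + 1 + m).factorial) =
      x ^ k / ((k.factorial : ℝ) * (k + (m + 1)).factorial) := by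
  have h1 : ((k + 1).factorial : ℝ) = (k + 1 : ℕ) * k.factorial := by
    rw [Nat.factorial_succ]; push_cast; ring
  have h2 : k + 1 + m = k + (m + 1) := by ring
  rw [h1, h2]
  have : (k.factorial : ℝ) ≠ 0 := by positivity
  have : ((k + (m + 1)).factorial : ℝ) ≠ 0 := by positivity
  have : ((k + 1 : ℕ) : ℝ) ≠ 0 := by positivity
  field_simp

lemma summable_nat_mul_pow_div_factorial (M : ℝ) :
    Summable fun k : ℕ => (k : ℝ) * M ^ (k - 1) / k.factorial := by
  rw [← summable_nat_add_iff 1]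
  refine (Real.summable_pow_div_factorial M).congr fun k => ?_
  have : (k.factorial : ℝ) ≠ 0 := by positivity
  rw [Nat.factorial_succ, Nat.add_sub_cancel]
  push_cast
  field_simp

/-- Termwise differentiation on the ball of radius `M = |x| + 1`, where the differentiated series is
dominated by `∑ k M^(k-1) / k!`. -/
lemma hasDerivAt_besselSeries (m : ℕ) (x : ℝ) :
    HasDerivAt (besselSeries m) (besselSeries (m + 1) x) x := by
  have key := hasDerivAt_tsum_of_isPreconnected (t := Metric.ball (0 : ℝ) (|x| + 1))
    (g := fun (k : ℕ) (y : ℝ) => y ^ k / ((k.factorial : ℝ) * (k + m).factorial))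
    (g' := fun (k : ℕ) (y : ℝ) => (k : ℝ) * y ^ (k - 1) / ((k.factorial : ℝ) * (k + m).factorial))
    (y₀ := x) (y := x)
    (summable_nat_mul_pow_div_factorial (|x| + 1)) Metric.isOpen_ball
    (convex_ball _ _).isPreconnected (fun k y _ => (hasDerivAt_pow k y).div_const _)
    (fun k y hy => ?_) (by simp) (summable_besselSeries m x) (by simp)
  · refine key.congr_deriv ?_
    rw [Summable.tsum_eq_zero_add]
    · simp only [Nat.cast_zero, zero_mul, zero_div, zero_add, Nat.add_sub_cancel,
        besselSeries_shift]
      rfl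
    · rw [← summable_nat_add_iff 1]
      simp only [Nat.add_sub_cancel, besselSeries_shift]
      exact summable_besselSeries (m + 1) x
  · have hy' : |y| ≤ |x| + 1 := by
      have := mem_ball_zero_iff.1 hy
      rw [Real.norm_eq_abs] at this
      exact this.le
    rw [norm_div, norm_mul, norm_pow, Real.norm_eq_abs, Real.norm_eq_abs, Real.norm_eq_abs,
      abs_of_pos (by positivity : (0 : ℝ) < (k.factorial : ℝ) * (k + m).factorial), Nat.abs_cast]
    have h1 : (1 : ℝ) ≤ (k + m).factorial := by exact_mod_cast Nat.factorial_pos _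
    have h2 : (0 : ℝ) < k.factorial := by positivity
    gcongr
    nlinarith

/-- Write `1/(k+m)! = (k+m+1)/(k+m+1)!` and split the numerator into `m + 1` and `k`; the second
part, reindexed, is `x` times the series of index `m + 2`. As differentiation raises `m`, this is
the differential equation `F = (m+1) F' + x F''`. -/
lemma besselSeries_recurrence (m : ℕ) (x : ℝ) :
    besselSeries m x = (m + 1) * besselSeries (m + 1) x + x * besselSeries (m + 2) x := by
  have e : ∀ k : ℕ, x ^ (k + 1) * (k + 1 : ℕ) /
      (((k + 1).factorial : ℝ) * (k + 1 + (m + 1)).factorial) =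
      x * (x ^ k / ((k.factorial : ℝ) * (k + (m + 2)).factorial)) := fun k => by
    rw [← besselSeries_shift (m + 1) k x]; ring
  have hs : Summable fun k : ℕ =>
      x ^ k * k / ((k.factorial : ℝ) * (k + (m + 1)).factorial) := by
    rw [← summable_nat_add_iff 1]
    simp only [e]
    exact (summable_besselSeries (m + 2) x).mul_left x
  have h2 : x * besselSeries (m + 2) x =
      ∑' k : ℕ, x ^ k * k / ((k.factorial : ℝ) * (k + (m + 1)).factorial) := by
    rw [hs.tsum_eq_zero_add]
    simp only [e, Nat.cast_zero, mul_zero, zero_div, zero_add, tsum_mul_left]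
    rfl
  rw [h2]
  unfold besselSeries
  rw [← tsum_mul_left, ← Summable.tsum_add ((summable_besselSeries (m + 1) x).mul_left _) hs]
  refine tsum_congr fun k => ?_
  have h1 : ((k + (m + 1)).factorial : ℝ) = (k + m + 1) * (k + m).factorial := by
    rw [← add_assoc, Nat.factorial_succ]; push_cast; ring
  rw [h1]
  have : (k.factorial : ℝ) ≠ 0 := by positivity
  have : ((k + m).factorial : ℝ) ≠ 0 := by positivity
  have : ((k : ℝ) + m + 1) ≠ 0 := by positivity
  field_simp
  ring

lemma contDiff_besselSeries (m : ℕ) : ContDiff ℝ ∞ (besselSeries m) := by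
  refine contDiff_infty.2 fun n => ?_
  induction n generalizing m with
  | zero =>
    exact contDiff_zero.2 (continuous_iff_continuousAt.2 fun x =>
      (hasDerivAt_besselSeries m x).continuousAt)
  | succ n ih =>
    have : deriv (besselSeries m) = besselSeries (m + 1) :=
      funext fun x => (hasDerivAt_besselSeries m x).deriv
    rw [show ((n + 1 : ℕ) : WithTop ℕ∞) = n + 1 by norm_cast, contDiff_succ_iff_deriv, this]
    exact ⟨fun x => (hasDerivAt_besselSeries m x).differentiableAt, by simp, ih (m + 1)⟩

lemma besselSeries_zero_pos {x : ℝ} (hx : 0 ≤ x) : 0 < besselSeries 0 x := by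
  have h := (summable_besselSeries 0 x).le_tsum 0 fun k _ => by positivity
  refine lt_of_lt_of_le ?_ h
  simp

/-- The modified Bessel function `I₀`. -/
noncomputable def besselI (ρ : ℝ) : ℝ := besselSeries 0 (ρ ^ 2 / 4)

/-- The derivative of `besselI`. -/
noncomputable def besselI' (ρ : ℝ) : ℝ := ρ / 2 * besselSeries 1 (ρ ^ 2 / 4)

lemma besselI_pos (ρ : ℝ) : 0 < besselI ρ := besselSeries_zero_pos (by positivity)

lemma contDiff_besselI : ContDiff ℝ ∞ besselI :=
  (contDiff_besselSeries 0).comp (by fun_prop)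

lemma hasDerivAt_besselI (ρ : ℝ) : HasDerivAt besselI (besselI' ρ) ρ := by
  have h : HasDerivAt (fun ρ : ℝ => ρ ^ 2 / 4) (ρ / 2) ρ := by
    refine ((hasDerivAt_pow 2 ρ).div_const 4).congr_deriv ?_
    push_cast; ring
  refine ((hasDerivAt_besselSeries 0 _).comp ρ h).congr_deriv ?_
  simp only [besselI', zero_add]; ring

/-- The recurrence for `m = 0`, at `ρ²/4`, becomes the modified Bessel equation `I'' + I'/ρ = I`. -/
lemma hasDerivAt_besselI' {ρ : ℝ} (hρ : ρ ≠ 0) :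
    HasDerivAt besselI' (besselI ρ - besselI' ρ / ρ) ρ := by
  have h : HasDerivAt (fun ρ : ℝ => ρ ^ 2 / 4) (ρ / 2) ρ := by
    refine ((hasDerivAt_pow 2 ρ).div_const 4).congr_deriv ?_
    push_cast; ring
  refine (((hasDerivAt_id ρ).div_const 2).mul
    ((hasDerivAt_besselSeries 1 _).comp ρ h)).congr_deriv ?_
  have := besselSeries_recurrence 0 (ρ ^ 2 / 4)
  simp only [besselI, besselI', this, id, Function.comp_apply]
  push_cast
  field_simp
  ring

/-- The quotient of the second solution of the radial equation by `besselI`, normalized to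
vanish at `2`. -/
noncomputable def besselQuot (ρ : ℝ) : ℝ := ∫ t in (2 : ℝ)..ρ, 1 / (t * besselI t ^ 2)

lemma besselQuot_two : besselQuot 2 = 0 := intervalIntegral.integral_same

lemma continuousOn_besselQuot_integrand :
    ContinuousOn (fun t : ℝ => 1 / (t * besselI t ^ 2)) (Set.Ioi 0) := by
  have := contDiff_besselI.continuous
  refine continuousOn_const.div (by fun_prop) fun t ht => ?_
  have := besselI_pos t
  have : (0 : ℝ) < t := ht
  positivity

lemma hasDerivAt_besselQuot {ρ : ℝ} (hρ : 0 < ρ) :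
    HasDerivAt besselQuot (1 / (ρ * besselI ρ ^ 2)) ρ := by
  have hs : Set.uIcc 2 ρ ⊆ Set.Ioi 0 := fun t ht => lt_of_lt_of_le (by positivity) ht.1
  refine intervalIntegral.integral_hasDerivAt_right
    (continuousOn_besselQuot_integrand.mono hs).intervalIntegrable
    (continuousOn_besselQuot_integrand.stronglyMeasurableAtFilter isOpen_Ioi _ hρ)
    (continuousOn_besselQuot_integrand.continuousAt (Ioi_mem_nhds hρ))

lemma contDiffOn_besselQuot : ContDiffOn ℝ ∞ besselQuot (Set.Ioi 0) := by
  rw [contDiffOn_infty_iff_deriv_of_isOpen isOpen_Ioi]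
  refine ⟨fun ρ hρ => (hasDerivAt_besselQuot hρ).differentiableAt.differentiableWithinAt, ?_⟩
  have : ContDiffOn ℝ ∞ (fun t : ℝ => 1 / (t * besselI t ^ 2)) (Set.Ioi 0) := by
    refine contDiffOn_const.div (contDiffOn_id.mul (contDiff_besselI.contDiffOn.pow 2))
      fun t ht => ?_
    have := besselI_pos t
    have : (0 : ℝ) < t := ht
    positivity
  exact this.congr fun ρ hρ => (hasDerivAt_besselQuot hρ).deriv

/-- Since `I > 0`, the sign of a radial solution is that of `α + β J`; monotonicity of `J` therefore
controls the signs of the profiles and of their difference. -/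
lemma strictMonoOn_besselQuot : StrictMonoOn besselQuot (Set.Ioi 0) := by
  refine strictMonoOn_of_deriv_pos (convex_Ioi 0) contDiffOn_besselQuot.continuousOn
    fun ρ hρ => ?_
  rw [interior_Ioi] at hρ
  rw [(hasDerivAt_besselQuot hρ).deriv]
  have := besselI_pos ρ
  have : (0 : ℝ) < ρ := hρ
  positivity

/-- The general solution `f` of `f'' + f' / ρ = f` on `(0, ∞)`. -/
noncomputable def radialSol (α β ρ : ℝ) : ℝ := besselI ρ * (α + β * besselQuot ρ)

/-- The derivative of `radialSol`. -/
noncomputable def radialSol' (α β ρ : ℝ) : ℝ :=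
  besselI' ρ * (α + β * besselQuot ρ) + β / (ρ * besselI ρ)

lemma contDiffOn_radialSol (α β : ℝ) : ContDiffOn ℝ ∞ (radialSol α β) (Set.Ioi 0) :=
  contDiff_besselI.contDiffOn.mul
    (contDiffOn_const.add (contDiffOn_const.mul contDiffOn_besselQuot))

lemma hasDerivAt_radialSol (α β : ℝ) {ρ : ℝ} (hρ : 0 < ρ) :
    HasDerivAt (radialSol α β) (radialSol' α β ρ) ρ := by
  refine ((hasDerivAt_besselI ρ).mul
    (((hasDerivAt_besselQuot hρ).const_mul β).const_add α)).congr_deriv ?_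
  have := (besselI_pos ρ).ne'
  have := hρ.ne'
  simp only [radialSol']
  field_simp

/-- Reduction of order: with `J' = 1/(ρ I²)` the two terms `β I'/(ρ I²)` cancel, and what is left is
the radial equation `f'' = f - f'/ρ`. -/
lemma hasDerivAt_radialSol' (α β : ℝ) {ρ : ℝ} (hρ : 0 < ρ) :
    HasDerivAt (radialSol' α β) (radialSol α β ρ - radialSol' α β ρ / ρ) ρ := by
  have h0 := (besselI_pos ρ).ne'
  have h1 := hρ.ne'
  refine (((hasDerivAt_besselI' h1).mul
    (((hasDerivAt_besselQuot hρ).const_mul β).const_add α)).add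
    (((hasDerivAt_const ρ β).div ((hasDerivAt_id ρ).mul (hasDerivAt_besselI ρ))
      (mul_ne_zero h1 h0)))).congr_deriv ?_
  simp only [radialSol', radialSol, id, Pi.mul_apply]
  field_simp
  ring

/-- After division by `I` the conditions prescribe an affine function of `J` at two points, and `J`
takes different values there. -/
lemma exists_radialSol {a b : ℝ} (ha : 0 < a) (hab : a < b) (p q : ℝ) :
    ∃ α β, radialSol α β a = p ∧ radialSol α β b = q := by
  have hJ := sub_ne_zero.2 (strictMonoOn_besselQuot ha (ha.trans hab : (0 : ℝ) < b) hab).ne'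
  have h0 := (besselI_pos a).ne'
  have h1 := (besselI_pos b).ne'
  set β := (q / besselI b - p / besselI a) / (besselQuot b - besselQuot a) with hβ
  refine ⟨p / besselI a - β * besselQuot a, β, ?_, ?_⟩
  · rw [radialSol, sub_add_cancel, mul_div_cancel₀ _ h0]
  · have : p / besselI a - β * besselQuot a + β * besselQuot b = q / besselI b := by
      have : β * (besselQuot b - besselQuot a) = q / besselI b - p / besselI a :=
        div_mul_cancel₀ _ hJ
      linarith
    rw [radialSol, this, mul_div_cancel₀ _ h1]

/-! ### Radial functions on the plane -/

lemma hasFDerivAt_norm_plane {x : Plane} (hx : x ≠ 0) :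
    HasFDerivAt (fun y : Plane => ‖y‖) (‖x‖⁻¹ • innerSL ℝ x) x := by
  have h := (hasStrictFDerivAt_norm_sq x).hasFDerivAt.sqrt (by simpa using hx)
  simp only [Real.sqrt_sq (norm_nonneg _)] at h
  refine h.congr_fderiv ?_
  have : ‖x‖ ≠ 0 := norm_ne_zero_iff.2 hx
  ext y
  simp
  field_simp

lemma hasFDerivAt_radial {f : ℝ → ℝ} {f' : ℝ} {x : Plane} (hx : x ≠ 0)
    (hf : HasDerivAt f f' ‖x‖) :
    HasFDerivAt (fun y : Plane => f ‖y‖) ((f' / ‖x‖) • innerSL ℝ x) x := by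
  refine (hf.comp_hasFDerivAt x (hasFDerivAt_norm_plane hx)).congr_fderiv ?_
  rw [smul_smul, div_eq_mul_inv]

lemma innerSL_single (x : Plane) (i : Fin 2) :
    innerSL ℝ x (EuclideanSpace.single i (1 : ℝ)) = x i := by
  simp [EuclideanSpace.inner_single_right]

lemma gradient_apply (f : Plane → ℝ) (x : Plane) (i : Fin 2) :
    ∇ f x i = fderiv ℝ f x (EuclideanSpace.single i 1) := by
  have h := inner_gradient_left (𝕜 := ℝ) (f := f) (x := x) (y := EuclideanSpace.single i (1 : ℝ))
  rw [← h, EuclideanSpace.inner_single_right]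
  simp

lemma gradient_radial {f : ℝ → ℝ} {f' : ℝ} {x : Plane} (hx : x ≠ 0)
    (hf : HasDerivAt f f' ‖x‖) : ∇ (fun y : Plane => f ‖y‖) x = (f' / ‖x‖) • x := by
  ext i
  rw [gradient_apply, (hasFDerivAt_radial hx hf).fderiv, _root_.smul_apply,
    innerSL_single]
  simp

lemma laplacian_eq_sum {f : Plane → ℝ} {x : Plane} (hf : ContDiffAt ℝ 2 f x) :
    (Δ f) x = ∑ i : Fin 2, fderiv ℝ (fun y => fderiv ℝ f y (EuclideanSpace.single i 1)) x
      (EuclideanSpace.single i 1) := by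
  rw [InnerProductSpace.laplacian_eq_iteratedFDeriv_orthonormalBasis f
    (EuclideanSpace.basisFun (Fin 2) ℝ)]
  refine Finset.sum_congr rfl fun i _ => ?_
  have hd : DifferentiableAt ℝ (fderiv ℝ f) x :=
    (hf.fderiv_right (m := 1) (by norm_num)).differentiableAt (by norm_num)
  rw [iteratedFDeriv_two_apply, fderiv_clm_apply hd (differentiableAt_const _)]
  simp

lemma sum_sq_eq_norm_sq (x : Plane) : ∑ i : Fin 2, x i * x i = ‖x‖ ^ 2 := by
  rw [EuclideanSpace.norm_sq_eq]
  exact Finset.sum_congr rfl fun i _ => by rw [Real.norm_eq_abs, sq_abs, sq]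

/-- The gradient is `m(|y|) y` with `m = f₁/ρ`, so the pure second derivatives are `m' x_i²/ρ + m`.
Their sum in dimension two is `ρ m' + 2m`. -/
lemma laplacian_radial {f f₁ f₂ : ℝ → ℝ} (hf : ContDiffOn ℝ ∞ f (Set.Ioi 0))
    (h₁ : ∀ ρ, 0 < ρ → HasDerivAt f (f₁ ρ) ρ) (h₂ : ∀ ρ, 0 < ρ → HasDerivAt f₁ (f₂ ρ) ρ)
    {x : Plane} (hx : x ≠ 0) :
    (Δ fun y : Plane => f ‖y‖) x = f₂ ‖x‖ + f₁ ‖x‖ / ‖x‖ := by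
  have hx' : 0 < ‖x‖ := norm_pos_iff.2 hx
  have hc : ContDiffAt ℝ 2 (fun y : Plane => f ‖y‖) x :=
    ((hf.contDiffAt (Ioi_mem_nhds hx')).of_le (by norm_cast)).comp x
      (contDiffAt_norm ℝ hx)
  rw [laplacian_eq_sum hc]
  have hm : HasDerivAt (fun ρ => f₁ ρ / ρ) ((f₂ ‖x‖ * ‖x‖ - f₁ ‖x‖) / ‖x‖ ^ 2) ‖x‖ := by
    refine ((h₂ _ hx').div (hasDerivAt_id _) hx'.ne').congr_deriv ?_
    simp
  have key : ∀ i : Fin 2, fderiv ℝ (fun y => fderiv ℝ (fun y : Plane => f ‖y‖) y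
      (EuclideanSpace.single i 1)) x (EuclideanSpace.single i 1) =
      ((f₂ ‖x‖ * ‖x‖ - f₁ ‖x‖) / ‖x‖ ^ 2 / ‖x‖) * (x i * x i) + f₁ ‖x‖ / ‖x‖ := fun i => by
    have he : (fun y => fderiv ℝ (fun y : Plane => f ‖y‖) y (EuclideanSpace.single i 1)) =ᶠ[𝓝 x]
        fun y : Plane => (f₁ ‖y‖ / ‖y‖) * y i := by
      filter_upwards [isOpen_ne.mem_nhds hx] with y hy
      rw [(hasFDerivAt_radial hy (h₁ _ (norm_pos_iff.2 hy))).fderiv,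
        _root_.smul_apply, innerSL_single, smul_eq_mul]
    have hp : HasFDerivAt (fun y : Plane => y i) (EuclideanSpace.proj i : Plane →L[ℝ] ℝ) x :=
      (EuclideanSpace.proj i : Plane →L[ℝ] ℝ).hasFDerivAt
    rw [he.fderiv_eq, ((hasFDerivAt_radial hx hm).fun_mul hp).fderiv]
    simp [EuclideanSpace.inner_single_right]
    ring
  simp only [key, Finset.sum_add_distrib, ← Finset.mul_sum, sum_sq_eq_norm_sq]
  simp
  field_simp
  ring

/-! ### The Dirichlet problems -/

lemma isDirichletSolution_radialSol {a b p q α β : ℝ} (ha : 0 < a) (hp : radialSol α β a = p)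
    (hq : radialSol α β b = q) {u : Plane → ℝ} (hu : ∀ x ∈ closedAnnulus a b,
      u x = radialSol α β ‖x‖) (hab : a < b) :
    IsDirichletSolution a b p q u := by
  have hsub : (annulus a b : Set Plane) ⊆ closedAnnulus a b := fun x hx =>
    ⟨(not_le.1 fun h => hx.2 (mem_closedBall_zero_iff.2 h)).le, (mem_ball_zero_iff.1 hx.1).le⟩
  have hne : ∀ x ∈ closedAnnulus a b, x ≠ 0 := fun x hx h0 => by
    have := hx.1
    rw [h0, norm_zero] at this
    linarith
  have hcd : ∀ x ∈ closedAnnulus a b, ContDiffAt ℝ 2 (fun x : Plane => radialSol α β ‖x‖) x :=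
    fun x hx => (((contDiffOn_radialSol α β).contDiffAt
      (Ioi_mem_nhds (norm_pos_iff.2 (hne x hx)))).of_le (by norm_cast)).comp x
      (contDiffAt_norm ℝ (hne x hx))
  refine ⟨?_, ?_, fun x hx => ?_, fun x hx => ?_, fun x hx => ?_⟩
  · exact ContinuousOn.congr (fun x hx => (hcd x hx).continuousAt.continuousWithinAt) hu
  · exact ContDiffOn.congr (fun x hx => (hcd x (hsub hx)).contDiffWithinAt)
      fun x hx => hu x (hsub hx)
  · have he : u =ᶠ[𝓝 x] fun y : Plane => radialSol α β ‖y‖ := by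
      filter_upwards [(annulus a b).isOpen.mem_nhds hx] with y hy using hu y (hsub hy)
    rw [(InnerProductSpace.laplacian_congr_nhds he).eq_of_nhds, he.eq_of_nhds,
      laplacian_radial (contDiffOn_radialSol α β) (fun ρ => hasDerivAt_radialSol α β)
      (fun ρ => hasDerivAt_radialSol' α β) (hne x (hsub hx))]
    ring
  · have h := mem_sphere_zero_iff_norm.1 hx
    rw [hu x ⟨h.ge, h.le.trans hab.le⟩, h, hp]
  · have h := mem_sphere_zero_iff_norm.1 hx
    rw [hu x ⟨hab.le.trans h.ge, h.le⟩, h, hq]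

/-- A positive second derivative would make the point a local minimum too; the function would then
be locally constant, with second derivative zero. -/
lemma deriv_deriv_nonpos_of_isLocalMax {g : ℝ → ℝ} {t : ℝ} (hg : ContinuousAt g t)
    (h : IsLocalMax g t) : deriv (deriv g) t ≤ 0 := by
  by_contra! hpos
  have hmin := isLocalMin_of_deriv_deriv_pos hpos h.deriv_eq_zero hg
  have he : g =ᶠ[𝓝 t] fun _ => g t := by
    filter_upwards [h, hmin] with s h1 h2 using le_antisymm h1 h2
  have := he.deriv.deriv_eq
  simp at this
  linarith

lemma fderiv_fderiv_nonpos_of_isLocalMax {w : Plane → ℝ} {x : Plane} (hw : ContDiffAt ℝ 2 w x)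
    (h : IsLocalMax w x) (v : Plane) : fderiv ℝ (fun y => fderiv ℝ w y v) x v ≤ 0 := by
  set c : ℝ → Plane := fun t => x + t • v with hc
  have hcd : ∀ t, HasDerivAt c v t := fun t => by
    exact (((hasDerivAt_id t).smul_const v).const_add x).congr_deriv (one_smul ℝ v)
  have hc0 : c 0 = x := by simp [hc]
  have hct : Tendsto c (𝓝 0) (𝓝 x) := by
    simpa [hc0] using (hcd 0).continuousAt.tendsto
  have hev : ∀ᶠ y in 𝓝 x, DifferentiableAt ℝ w y :=
    (hw.eventually (by simp)).mono fun y hy => hy.differentiableAt (by norm_num)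
  have hd1 : deriv (fun t => w (c t)) =ᶠ[𝓝 0] fun t => fderiv ℝ w (c t) v := by
    filter_upwards [hct.eventually hev] with t ht
    exact (ht.hasFDerivAt.comp_hasDerivAt t (hcd t)).deriv
  have hd2 : DifferentiableAt ℝ (fun y => fderiv ℝ w y v) (c 0) := by
    rw [hc0]
    exact ((hw.fderiv_right (m := 1) (by norm_num)).differentiableAt (by norm_num)).clm_apply
      (differentiableAt_const _)
  have := deriv_deriv_nonpos_of_isLocalMax (g := fun t => w (c t)) (t := 0)
    (by
      have := hw.continuousAt
      rw [← hc0] at this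
      exact this.comp (hcd 0).continuousAt)
    (by
      have := hct.eventually h
      simpa [IsLocalMax, IsMaxFilter, hc0] using this)
  have h2 : HasDerivAt (fun t => fderiv ℝ w (c t) v)
      (fderiv ℝ (fun y => fderiv ℝ w y v) (c 0) v) 0 :=
    hd2.hasFDerivAt.comp_hasDerivAt 0 (hcd 0)
  rw [hd1.deriv_eq, h2.deriv, hc0] at this
  exact this

lemma isCompact_closedAnnulus (a b : ℝ) : IsCompact (closedAnnulus a b) := by
  refine (isCompact_closedBall (0 : Plane) b).of_isClosed_subset ?_ fun x hx =>
    mem_closedBall_zero_iff.2 hx.2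
  exact (isClosed_le continuous_const continuous_norm).inter
    (isClosed_le continuous_norm continuous_const)

lemma mem_annulus {a b : ℝ} {x : Plane} : x ∈ annulus a b ↔ a < ‖x‖ ∧ ‖x‖ < b := by
  change x ∈ Metric.ball 0 b \ Metric.closedBall 0 a ↔ _
  rw [Set.mem_sdiff, mem_ball_zero_iff, mem_closedBall_zero_iff, not_le, and_comm]

/-- The weak maximum principle for `-Δu + u = 0`. -/
lemma IsDirichletSolution.le {a b p q : ℝ} {u v : Plane → ℝ} (hu : IsDirichletSolution a b p q u)
    (hv : IsDirichletSolution a b p q v) {x : Plane} (hx : x ∈ closedAnnulus a b) :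
    u x ≤ v x := by
  obtain ⟨z, hz, hmax⟩ := (isCompact_closedAnnulus a b).exists_isMaxOn ⟨x, hx⟩
    (hu.continuousOn.sub hv.continuousOn)
  by_contra! hlt
  have hpos : 0 < u z - v z := lt_of_lt_of_le (sub_pos.2 hlt) (hmax hx)
  -- The boundary data agree, so a positive maximum of `u - v` is attained in the open annulus.
  have hza : z ∈ annulus a b := by
    rw [mem_annulus]
    refine ⟨lt_of_le_of_ne hz.1 fun h => ?_, lt_of_le_of_ne hz.2 fun h => ?_⟩
    · have h' := mem_sphere_zero_iff_norm.2 h.symm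
      rw [hu.inner_boundary z h', hv.inner_boundary z h'] at hpos
      linarith
    · have h' := mem_sphere_zero_iff_norm.2 h
      rw [hu.outer_boundary z h', hv.outer_boundary z h'] at hpos
      linarith
  have hn := (annulus a b).isOpen.mem_nhds hza
  have hcu := hu.contDiffOn.contDiffAt hn
  have hcv := hv.contDiffOn.contDiffAt hn
  have hloc : IsLocalMax (u - v) z := by
    filter_upwards [hn] with y hy
    rw [SetLike.mem_coe, mem_annulus] at hy
    exact hmax (show y ∈ closedAnnulus a b from ⟨hy.1.le, hy.2.le⟩)
  -- The equation gives `Δ(u - v) = u - v > 0` at `z`, against the second-order condition at a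
  -- maximum.
  have hlap : (Δ (u - v)) z ≤ 0 := by
    have hc : ContDiffAt ℝ 2 (u - v) z := hcu.sub hcv
    rw [laplacian_eq_sum hc]
    exact Finset.sum_nonpos fun i _ => fderiv_fderiv_nonpos_of_isLocalMax hc hloc _
  rw [hcu.laplacian_sub hcv] at hlap
  have h1 := hu.equation z hza
  have h2 := hv.equation z hza
  linarith

lemma IsDirichletSolution.eqOn {a b p q : ℝ} {u v : Plane → ℝ}
    (hu : IsDirichletSolution a b p q u) (hv : IsDirichletSolution a b p q v) :
    Set.EqOn u v (closedAnnulus a b) :=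
  fun _ hx => le_antisymm (hu.le hv hx) (hv.le hu hx)

theorem dirichlet_existsUnique_radial {a b : ℝ} (ha : 0 < a) (hab : a < b) (p q : ℝ) :
    (∃ u, IsDirichletSolution a b p q u) ∧
      (∀ u v, IsDirichletSolution a b p q u → IsDirichletSolution a b p q v →
        Set.EqOn u v (closedAnnulus a b)) ∧
      (∀ u, IsDirichletSolution a b p q u → IsRadialOn (closedAnnulus a b) u) := by
  obtain ⟨α, β, hp, hq⟩ := exists_radialSol ha hab p q
  have h := isDirichletSolution_radialSol ha hp hq
    (u := fun x => radialSol α β ‖x‖) (fun _ _ => rfl) hab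
  refine ⟨⟨_, h⟩, fun u v hu hv => hu.eqOn hv, fun u hu x hx y hy hxy => ?_⟩
  rw [hu.eqOn h hx, hu.eqOn h hy]
  simp only [hxy]

/-! ### Geometry of the annulus -/

lemma norm_eq_of_mem_frontier_annulus {a b : ℝ} {x : Plane}
    (hx : x ∈ frontier (annulus a b : Set Plane)) : ‖x‖ = a ∨ ‖x‖ = b := by
  rw [frontier, (annulus a b).isOpen.interior_eq] at hx
  have hsub : closure (annulus a b : Set Plane) ⊆ closedAnnulus a b :=
    closure_minimal (fun y hy => by
      rw [SetLike.mem_coe, mem_annulus] at hy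
      exact ⟨hy.1.le, hy.2.le⟩) (isCompact_closedAnnulus a b).isClosed
  obtain ⟨h1, h2⟩ := hsub hx.1
  by_contra! h
  exact hx.2 (mem_annulus.2 ⟨lt_of_le_of_ne h1 h.1.symm, lt_of_le_of_ne h2 h.2⟩)

/-- The annulus is the image of `(a, b)` times the unit circle under scaling, and the circle is
connected because the dimension exceeds one. -/
lemma isConnected_annulus {a b : ℝ} (ha : 0 < a) (hab : a < b) :
    IsConnected (annulus a b : Set Plane) := by
  have hr : 1 < Module.rank ℝ Plane := by
    rw [← Module.finrank_eq_rank, finrank_euclideanSpace_fin]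
    norm_num
  have h := ((isConnected_Ioo hab).prod (isConnected_sphere hr (0 : Plane) zero_le_one)).image
    (fun p : ℝ × Plane => p.1 • p.2) (by fun_prop)
  convert h using 1
  ext x
  rw [SetLike.mem_coe, mem_annulus]
  constructor
  · intro hx
    have h0 : ‖x‖ ≠ 0 := (ha.trans hx.1).ne'
    refine ⟨(‖x‖, ‖x‖⁻¹ • x), ⟨hx, ?_⟩, ?_⟩
    · rw [mem_sphere_zero_iff_norm, norm_smul, norm_inv, norm_norm, inv_mul_cancel₀ h0]
    · simp only [smul_smul, mul_inv_cancel₀ h0, one_smul]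
  · rintro ⟨⟨ρ, e⟩, ⟨hρ, he⟩, rfl⟩
    have he' := mem_sphere_zero_iff_norm.1 he
    simp only at he' hρ
    simpa [norm_smul, he', abs_of_pos (ha.trans hρ.1)] using hρ

lemma isSmoothBoundedDomain_annulus {a b : ℝ} (ha : 0 < a) (hab : a < b) :
    IsSmoothBoundedDomain (annulus a b) := by
  refine ⟨Metric.isBounded_ball.subset Set.sdiff_subset, isConnected_annulus ha hab,
    fun x hx => ?_⟩
  have hd : HasFDerivAt (fun y : Plane => ‖y‖ ^ 2) (2 • innerSL ℝ x) x :=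
    (hasStrictFDerivAt_norm_sq x).hasFDerivAt
  have hne : ‖x‖ ≠ 0 → (2 • innerSL ℝ x : Plane →L[ℝ] ℝ) ≠ 0 := fun h h0 => by
    have := DFunLike.congr_fun h0 x
    simp at this
    exact h (by simp [this])
  obtain h | h := norm_eq_of_mem_frontier_annulus hx
  -- Each neighbourhood is chosen so that the condition at the other boundary circle holds
  -- automatically on it.
  · refine ⟨Metric.ball 0 b, Metric.isOpen_ball, by simpa [h] using hab,
      fun y => a ^ 2 - ‖y‖ ^ 2, contDiff_const.sub (contDiff_norm_sq ℝ), ?_, by simp [h], ?_⟩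
    · rw [(hd.const_sub _).fderiv]
      exact neg_ne_zero.2 (hne (by rw [h]; exact ha.ne'))
    · ext y
      simp only [Set.mem_inter_iff, SetLike.mem_coe, mem_annulus, mem_ball_zero_iff,
        Set.mem_ofPred_eq, sub_neg, sq_lt_sq₀ ha.le (norm_nonneg y)]
      tauto
  · refine ⟨{y | a < ‖y‖}, isOpen_lt continuous_const continuous_norm, by simpa [h] using hab,
      fun y => ‖y‖ ^ 2 - b ^ 2, (contDiff_norm_sq ℝ).sub contDiff_const, ?_, by simp [h], ?_⟩
    · rw [(hd.sub_const _).fderiv]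
      exact hne (by rw [h]; exact (ha.trans hab).ne')
    · ext y
      simp only [Set.mem_inter_iff, SetLike.mem_coe, mem_annulus,
        Set.mem_ofPred_eq, sub_neg, sq_lt_sq₀ (norm_nonneg y) (ha.trans hab).le]
      tauto

/-- A star centre of a nonempty set belongs to it; by symmetry so does its antipode, and the segment
between them passes through the origin. -/
lemma not_starConvex_annulus {a b : ℝ} (ha : 0 < a) (hab : a < b) :
    ¬ ∃ x, StarConvex ℝ x (annulus a b : Set Plane) := by
  rintro ⟨x, hx⟩
  obtain ⟨y, hy⟩ := (isConnected_annulus ha hab).nonempty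
  have h1 : x ∈ annulus a b := by
    simpa using hx hy zero_le_one le_rfl (add_zero 1)
  have h2 : -x ∈ annulus a b := by
    rw [mem_annulus] at h1 ⊢
    simpa using h1
  have h3 := hx h2 (a := 1 / 2) (b := 1 / 2) (by norm_num) (by norm_num) (by norm_num)
  rw [SetLike.mem_coe, mem_annulus] at h3
  simp at h3
  linarith

/-! ### The circle and polar coordinates -/

/-- The point of the unit circle at angle `θ`. -/
noncomputable def circlePoint (θ : ℝ) : Plane := !₂[Real.cos θ, Real.sin θ]

lemma norm_circlePoint (θ : ℝ) : ‖circlePoint θ‖ = 1 := by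
  rw [EuclideanSpace.norm_eq, Fin.sum_univ_two]
  simp [circlePoint]

lemma continuous_circlePoint : Continuous circlePoint := by
  unfold circlePoint
  fun_prop

lemma norm_smul_circlePoint {ρ : ℝ} (hρ : 0 ≤ ρ) (θ : ℝ) : ‖ρ • circlePoint θ‖ = ρ := by
  rw [norm_smul, norm_circlePoint, mul_one, Real.norm_of_nonneg hρ]

lemma exists_eq_smul_circlePoint (x : Plane) :
    ∃ θ ∈ Set.Ioc (-Real.pi) Real.pi, x = ‖x‖ • circlePoint θ := by
  set z : ℂ := ⟨x 0, x 1⟩ with hz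
  have hn : ‖z‖ = ‖x‖ := by
    rw [EuclideanSpace.norm_eq, Fin.sum_univ_two, Complex.norm_eq_sqrt_sq_add_sq]
    simp [hz]
  refine ⟨z.arg, z.arg_mem_Ioc, ?_⟩
  ext i
  fin_cases i
  · have := (Complex.norm_mul_cos_arg z).symm
    rw [hn] at this
    exact this
  · have := (Complex.norm_mul_sin_arg z).symm
    rw [hn] at this
    exact this

lemma dist_circlePoint (s t : ℝ) :
    dist (circlePoint s) (circlePoint t) = 2 * |Real.sin ((s - t) / 2)| := by
  rw [EuclideanSpace.dist_eq, Fin.sum_univ_two]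
  have h1 : dist (circlePoint s 0) (circlePoint t 0) ^ 2 +
      dist (circlePoint s 1) (circlePoint t 1) ^ 2 = (2 * |Real.sin ((s - t) / 2)|) ^ 2 := by
    simp only [Real.dist_eq, sq_abs, circlePoint, mul_pow]
    have h2 : Real.cos (s - t) = 1 - 2 * Real.sin ((s - t) / 2) ^ 2 := by
      have := Real.cos_sq' ((s - t) / 2)
      rw [show s - t = 2 * ((s - t) / 2) by ring, Real.cos_two_mul, this]
      ring_nf
    rw [Real.cos_sub] at h2
    have h3 := Real.sin_sq_add_cos_sq s
    have h4 := Real.sin_sq_add_cos_sq t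
    simp
    linarith
  rw [h1, Real.sqrt_sq (by positivity)]

/-- The parametrization of the circle of radius `2` by the angle. -/
noncomputable def circleParam (θ : ℝ) : Plane := (2 : ℝ) • circlePoint θ

lemma dist_circleParam (s t : ℝ) :
    dist (circleParam s) (circleParam t) = 4 * |Real.sin ((s - t) / 2)| := by
  rw [circleParam, circleParam, dist_smul₀, dist_circlePoint]
  norm_num
  ring

lemma continuous_circleParam : Continuous circleParam := continuous_circlePoint.const_smul (2 : ℝ)

lemma lipschitzWith_circleParam : LipschitzWith 2 circleParam := by
  refine LipschitzWith.of_dist_le_mul fun s t => ?_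
  rw [dist_circleParam, Real.dist_eq]
  have := Real.abs_sin_le_abs (x := (s - t) / 2)
  rw [abs_div, abs_two] at this
  push_cast
  linarith

lemma injOn_circleParam : Set.InjOn circleParam (Set.Ioc (-Real.pi) Real.pi) := by
  intro s hs t ht h
  have h0 := dist_circleParam s t
  rw [h, dist_self] at h0
  have h1 : Real.sin ((s - t) / 2) = 0 := abs_eq_zero.1 (by linarith)
  rw [Real.sin_eq_zero_iff_of_lt_of_lt (by linarith [hs.1, ht.2]) (by linarith [hs.2, ht.1])] at h1
  linarith

lemma image_circleParam :
    circleParam '' Set.Ioc (-Real.pi) Real.pi = Metric.sphere (0 : Plane) 2 := by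
  ext x
  rw [mem_sphere_zero_iff_norm]
  constructor
  · rintro ⟨θ, -, rfl⟩
    exact norm_smul_circlePoint zero_le_two θ
  · intro hx
    obtain ⟨θ, hθ, h⟩ := exists_eq_smul_circlePoint x
    exact ⟨θ, hθ, by rw [h, hx]; rfl⟩

/-- The chord `4 |sin((s-t)/2)|` is asymptotic to `2 |s-t|`, so locally the inverse of the
parametrization is Lipschitz with any constant above `1/2`. -/
lemma exists_le_mul_dist_circleParam {K : ℝ} (hK : 1 / 2 < K) :
    ∃ δ > 0, ∀ s t, |s - t| ≤ δ → dist s t ≤ K * dist (circleParam s) (circleParam t) := by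
  have hK1 : 0 < 1 - 1 / (2 * K) := by
    rw [sub_pos, div_lt_one (by linarith)]
    linarith
  -- With `x = |s-t|/2`, the bound `x ≤ 1` gives `sin x ≥ x - x³/6 ≥ x (1 - x)`, and `x ≤ 1 -
  -- 1/(2K)` makes this at least `x/(2K)`.
  refine ⟨2 * min 1 (1 - 1 / (2 * K)), by positivity, fun s t hst => ?_⟩
  rw [dist_circleParam, Real.dist_eq]
  set x := |s - t| / 2 with hx
  have hx0 : 0 ≤ x := by positivity
  have hx1 : x ≤ 1 := by linarith [min_le_left 1 (1 - 1 / (2 * K))]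
  have hx2 : x ≤ 1 - 1 / (2 * K) := by linarith [min_le_right 1 (1 - 1 / (2 * K))]
  have hsin : |Real.sin ((s - t) / 2)| = Real.sin x := by
    have h : |(s - t) / 2| = x := by rw [abs_div, abs_two]
    rw [← h, ← Real.abs_sin_eq_sin_abs_of_abs_le_pi]
    rw [h]
    linarith [Real.pi_gt_three]
  rw [hsin]
  obtain h0 | h0 := hx0.eq_or_lt
  · rw [← h0, Real.sin_zero]
    linarith
  · have h1 := Real.sin_gt_sub_cube h0
    have h2 : 1 / (2 * K) * x ≤ x - x ^ 3 / 6 := by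
      have : x ^ 3 ≤ x * x := by nlinarith
      nlinarith
    have h3 : x = 2 * K * (1 / (2 * K) * x) := by
      have : K ≠ 0 := by linarith
      field_simp
    have h4 : x ≤ 2 * K * Real.sin x :=
      h3.le.trans (mul_le_mul_of_nonneg_left (h2.trans h1.le) (by linarith))
    linarith

/-! ### Hausdorff measure on the circle of radius 2. -/

lemma hausdorffMeasure_image_circleParam_le (A : Set ℝ) :
    μH[1] (circleParam '' A) ≤ 2 * volume A := by
  have := lipschitzWith_circleParam.hausdorffMeasure_image_le zero_le_one A
  simpa [hausdorffMeasure_real] using this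

/-- The hypothesis says that the parametrization has a `K`-Lipschitz inverse on the image of `A`,
and on the line `H¹` is Lebesgue measure. -/
lemma volume_le_hausdorffMeasure_image_of_dist_le {K : NNReal} {A : Set ℝ}
    (h : ∀ s ∈ A, ∀ t ∈ A, dist s t ≤ K * dist (circleParam s) (circleParam t)) :
    volume A ≤ K * μH[1] (circleParam '' A) := by
  have hinj : Set.InjOn circleParam A := fun s hs t ht hst => by
    have := h s hs t ht
    rw [hst, dist_self, mul_zero] at this
    exact dist_le_zero.1 this
  have hl : LipschitzOnWith K (Function.invFunOn circleParam A) (circleParam '' A) := by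
    refine LipschitzOnWith.of_dist_le_mul ?_
    rintro _ ⟨s, hs, rfl⟩ _ ⟨t, ht, rfl⟩
    rw [hinj.leftInvOn_invFunOn hs, hinj.leftInvOn_invFunOn ht]
    exact h s hs t ht
  have := hl.hausdorffMeasure_image_le zero_le_one
  rwa [hinj.leftInvOn_invFunOn.image_image, hausdorffMeasure_real, ENNReal.rpow_one] at this

lemma measurableSet_image_circleParam {A : Set ℝ} (hA : MeasurableSet A)
    (hs : A ⊆ Set.Ioc (-Real.pi) Real.pi) : MeasurableSet (circleParam '' A) :=
  hA.image_of_continuousOn_injOn continuous_circleParam.continuousOn (injOn_circleParam.mono hs)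

/-- Passage from local to global by repeated bisection: the two halves have disjoint measurable
images, so the bounds add. -/
lemma volume_le_hausdorffMeasure_image {K : NNReal} {δ : ℝ} (hδ : ∀ s t, |s - t| ≤ δ →
      dist s t ≤ K * dist (circleParam s) (circleParam t)) (n : ℕ) :
    ∀ (a : ℝ) (A : Set ℝ), MeasurableSet A → A ⊆ Set.Ioc (-Real.pi) Real.pi →
      A ⊆ Set.Ioc a (a + 2 ^ n * δ) → volume A ≤ K * μH[1] (circleParam '' A) := by
  induction n with
  | zero =>
    intro a A _ _ hA
    refine volume_le_hausdorffMeasure_image_of_dist_le fun s hs t ht => hδ s t ?_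
    have h1 := hA hs
    have h2 := hA ht
    rw [abs_le]
    constructor <;> linarith [h1.1, h1.2, h2.1, h2.2]
  | succ n ih =>
    intro a A hm hT hA
    set b := a + 2 ^ n * δ with hb
    have h1 := ih a (A ∩ Set.Iic b) (hm.inter measurableSet_Iic)
      (Set.inter_subset_left.trans hT) fun x hx => ⟨(hA hx.1).1, hx.2⟩
    have h2 := ih b (A \ Set.Iic b) (hm.diff measurableSet_Iic)
      (Set.sdiff_subset.trans hT) fun x hx => ⟨not_le.1 hx.2, by
        have := (hA hx.1).2
        rw [pow_succ] at this
        linarith⟩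
    have hdisj : Disjoint (circleParam '' (A ∩ Set.Iic b)) (circleParam '' (A \ Set.Iic b)) := by
      rw [Set.disjoint_left]
      rintro _ ⟨s, hs, rfl⟩ ⟨t, ht, hts⟩
      exact ht.2 (injOn_circleParam (hT ht.1) (hT hs.1) hts ▸ hs.2)
    calc volume A = volume (A ∩ Set.Iic b) + volume (A \ Set.Iic b) :=
          (measure_inter_add_sdiff A measurableSet_Iic).symm
      _ ≤ K * μH[1] (circleParam '' (A ∩ Set.Iic b)) + K * μH[1] (circleParam '' (A \ Set.Iic b)) :=
          add_le_add h1 h2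
      _ = K * μH[1] (circleParam '' A) := by
          rw [← mul_add, ← measure_union hdisj (measurableSet_image_circleParam
            (hm.diff measurableSet_Iic) (Set.sdiff_subset.trans hT)), ← Set.image_union,
            Set.inter_union_sdiff]

/-- The upper bound is the Lipschitz constant 2; the lower bound follows by letting the local
Lipschitz constant `K` of the inverse decrease to `1/2`. -/
lemma hausdorffMeasure_image_circleParam {A : Set ℝ} (hA : MeasurableSet A)
    (hs : A ⊆ Set.Ioc (-Real.pi) Real.pi) : μH[1] (circleParam '' A) = 2 * volume A := by
  refine le_antisymm (hausdorffMeasure_image_circleParam_le A) ?_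
  have key : ∀ K : NNReal, 1 / 2 < K → volume A ≤ K * μH[1] (circleParam '' A) := fun K hK => by
    obtain ⟨δ, hδ0, hδ⟩ := exists_le_mul_dist_circleParam (K := K) (by exact_mod_cast hK)
    obtain ⟨n, hn⟩ := pow_unbounded_of_one_lt (2 * Real.pi / δ) one_lt_two
    refine volume_le_hausdorffMeasure_image hδ n (-Real.pi) A hA hs fun x hx => ?_
    have h := hs hx
    rw [div_lt_iff₀ hδ0] at hn
    exact ⟨h.1, by linarith [h.2]⟩
  have hvol : volume A ≠ ⊤ :=
    ne_top_of_le_ne_top measure_Ioc_lt_top.ne (measure_mono hs)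
  have hfin : μH[1] (circleParam '' A) ≠ ⊤ :=
    ne_top_of_le_ne_top (ENNReal.mul_ne_top (by simp) hvol)
      (hausdorffMeasure_image_circleParam_le A)
  rw [← ENNReal.toReal_le_toReal (ENNReal.mul_ne_top (by simp) hvol) hfin, ENNReal.toReal_mul]
  refine le_of_forall_pos_le_add fun ε hε => ?_
  set m := (μH[1] (circleParam '' A)).toReal with hm
  have hm0 : 0 ≤ m := ENNReal.toReal_nonneg
  -- Taking `K = 1/2 + ε/(2(m+1))` costs at most `ε` after doubling; the `+ 1` covers `m = 0`.
  have he : 0 < ε / (2 * (m + 1)) := by positivity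
  have hK := key (1 / 2 + ε / (2 * (m + 1))).toNNReal (by
    rw [Real.lt_toNNReal_iff_coe_lt]
    push_cast
    linarith)
  have h := ENNReal.toReal_mono (ENNReal.mul_ne_top (by simp) hfin) hK
  rw [ENNReal.toReal_mul, ← hm, ENNReal.coe_toReal, Real.coe_toNNReal _ (by positivity)] at h
  have h3 : ε / (2 * (m + 1)) * m ≤ ε / 2 := by
    rw [div_mul_eq_mul_div, div_le_div_iff₀ (by positivity) (by positivity)]
    nlinarith
  rw [ENNReal.toReal_ofNat]
  nlinarith

lemma hausdorffMeasure_restrict_circle :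
    (μH[1] : Measure Plane).restrict (Metric.sphere (0 : Plane) 2) =
      (2 : ℝ≥0∞) • (volume.restrict (Set.Ioc (-Real.pi) Real.pi)).map circleParam := by
  ext B hB
  have hp : MeasurableSet (circleParam ⁻¹' B) := continuous_circleParam.measurable hB
  rw [Measure.restrict_apply hB, Measure.smul_apply,
    Measure.map_apply continuous_circleParam.measurable hB, Measure.restrict_apply hp, smul_eq_mul,
    ← hausdorffMeasure_image_circleParam (hp.inter measurableSet_Ioc) Set.inter_subset_right,
    ← image_circleParam, Set.inter_comm, Set.inter_comm (circleParam ⁻¹' B),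
    Set.image_inter_preimage]

lemma integral_circle (φ : Plane → ℝ) (hφ : Continuous φ) :
    ∫ x in Metric.sphere (0 : Plane) 2, φ x ∂μH[1] =
      2 * ∫ θ in Set.Ioo (-Real.pi) Real.pi, φ ((2 : ℝ) • circlePoint θ) := by
  rw [hausdorffMeasure_restrict_circle, integral_smul_measure,
    integral_map continuous_circleParam.aemeasurable hφ.aestronglyMeasurable,
    integral_Ioc_eq_integral_Ioo]
  simp [circleParam]

lemma hausdorffMeasure_circle :
    (μH[1] : Measure Plane) (Metric.sphere 0 2) = 2 * ENNReal.ofReal (2 * Real.pi) := by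
  rw [← image_circleParam, hausdorffMeasure_image_circleParam measurableSet_Ioc subset_rfl,
    Real.volume_Ioc]
  ring_nf

lemma circleMeasure_eq (c : ℝ) : circleMeasure c =
    ENNReal.ofReal c • (μH[1] : Measure Plane).restrict (Metric.sphere 0 2) := rfl

lemma isFiniteMeasure_circleMeasure (c : ℝ) : IsFiniteMeasure (circleMeasure c) := by
  refine ⟨?_⟩
  rw [circleMeasure_eq, Measure.smul_apply, Measure.restrict_apply_univ, hausdorffMeasure_circle,
    smul_eq_mul]
  exact ENNReal.mul_lt_top ENNReal.ofReal_lt_top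
    (ENNReal.mul_lt_top ENNReal.ofNat_lt_top ENNReal.ofReal_lt_top)

lemma circleMeasure_ne_zero {c : ℝ} (hc : 0 < c) : circleMeasure c ≠ 0 := by
  intro h
  have := congrArg (fun μ : Measure Plane => μ Set.univ) h
  simp only [circleMeasure_eq, Measure.smul_apply, Measure.restrict_apply_univ,
    hausdorffMeasure_circle] at this
  simp at this
  rcases this with h | h <;> linarith [Real.pi_pos]

/-! ### Integration in polar coordinates. -/

lemma integral_polar (G : Plane → ℝ) :
    ∫ x, G x = ∫ p in Set.Ioi (0 : ℝ) ×ˢ Set.Ioo (-Real.pi) Real.pi,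
      p.1 * G (p.1 • circlePoint p.2) := by
  have hm : MeasurePreserving (fun x : Plane => MeasurableEquiv.finTwoArrow
      ((MeasurableEquiv.toLp 2 (Fin 2 → ℝ)).symm x)) volume (volume : Measure (ℝ × ℝ)) :=
    (volume_preserving_finTwoArrow ℝ).comp
      (EuclideanSpace.volume_preserving_symm_measurableEquiv_toLp (Fin 2))
  have he : MeasurableEmbedding (fun x : Plane => MeasurableEquiv.finTwoArrow
      ((MeasurableEquiv.toLp 2 (Fin 2 → ℝ)).symm x)) :=
    (MeasurableEquiv.finTwoArrow).measurableEmbedding.comp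
      (MeasurableEquiv.toLp 2 (Fin 2 → ℝ)).symm.measurableEmbedding
  have h1 := hm.integral_comp he (fun p : ℝ × ℝ => G !₂[p.1, p.2])
  have h2 : ∀ x : Plane, !₂[x 0, x 1] = x := fun x => by
    ext i
    fin_cases i <;> rfl
  rw [← integral_comp_polarCoord_symm] at h1
  refine Eq.trans ?_ (h1.trans ?_)
  · refine integral_congr_ae (Eventually.of_forall fun x => ?_)
    exact congrArg G (h2 x).symm
  · refine integral_congr_ae (Eventually.of_forall fun p => ?_)
    simp only [smul_eq_mul, polarCoord_symm_apply]
    congr 2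
    ext i
    fin_cases i <;> simp [circlePoint]

lemma integral_annulus_polar {a b : ℝ} (ha : 0 ≤ a) (G : Plane → ℝ) :
    ∫ x in annulus a b, G x = ∫ p in Set.Ioo a b ×ˢ Set.Ioo (-Real.pi) Real.pi,
      p.1 * G (p.1 • circlePoint p.2) := by
  have hm : MeasurableSet (Set.Ioo a b ×ˢ Set.Ioo (-Real.pi) Real.pi) :=
    measurableSet_Ioo.prod measurableSet_Ioo
  have hs : Set.Ioo a b ×ˢ Set.Ioo (-Real.pi) Real.pi ⊆
      Set.Ioi (0 : ℝ) ×ˢ Set.Ioo (-Real.pi) Real.pi :=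
    Set.prod_mono_left fun x hx => lt_of_le_of_lt ha hx.1
  rw [← integral_indicator (annulus a b).isOpen.measurableSet, integral_polar,
    ← integral_indicator hm, ← integral_indicator (measurableSet_Ioi.prod measurableSet_Ioo)]
  congr 1
  ext ⟨ρ, θ⟩
  by_cases h : (ρ, θ) ∈ Set.Ioi (0 : ℝ) ×ˢ Set.Ioo (-Real.pi) Real.pi
  · rw [Set.indicator_of_mem h]
    have hn := norm_smul_circlePoint (le_of_lt h.1) θ
    by_cases h' : (ρ, θ) ∈ Set.Ioo a b ×ˢ Set.Ioo (-Real.pi) Real.pi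
    · rw [Set.indicator_of_mem h', Set.indicator_of_mem]
      rw [SetLike.mem_coe, mem_annulus, hn]
      exact h'.1
    · rw [Set.indicator_of_notMem h', Set.indicator_of_notMem, mul_zero]
      rw [SetLike.mem_coe, mem_annulus, hn]
      exact fun h'' => h' ⟨h'', h.2⟩
  · rw [Set.indicator_of_notMem h, Set.indicator_of_notMem fun h' => h (hs h')]

/-- Integration by parts in the radial direction. -/
lemma integral_radial_by_parts {a b : ℝ} (ha : 0 < a) (hab : a < b) {B B' : ℝ → ℝ}
    (hB : ∀ ρ, 0 < ρ → HasDerivAt B (B' ρ) ρ) (hB' : ContinuousOn B' (Set.Ioi 0))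
    {φ : Plane → ℝ} (hφ : ContDiffOn ℝ 1 φ {0}ᶜ) :
    ∫ x in annulus a b, ((B' ‖x‖ + B ‖x‖ / ‖x‖) * φ x + B ‖x‖ / ‖x‖ * fderiv ℝ φ x x) =
      (∫ θ in Set.Ioo (-Real.pi) Real.pi, b * B b * φ (b • circlePoint θ)) -
        ∫ θ in Set.Ioo (-Real.pi) Real.pi, a * B a * φ (a • circlePoint θ) := by
  -- This is the `ρ`-derivative of `ρ B(ρ) φ(ρ e_θ)`, and also the given integrand times the polar
  -- Jacobian `ρ`. Regularity of `φ` is needed only away from the origin, which later admits factors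
  -- such as `x_j/|x|`.
  set D : ℝ → ℝ → ℝ := fun θ ρ => (ρ * B' ρ + B ρ) * φ (ρ • circlePoint θ) +
    ρ * B ρ * fderiv ℝ φ (ρ • circlePoint θ) (circlePoint θ) with hD
  have hne : ∀ {ρ : ℝ} (θ : ℝ), 0 < ρ → ρ • circlePoint θ ≠ 0 := fun θ hρ h => by
    have := norm_smul_circlePoint hρ.le θ
    rw [h, norm_zero] at this
    exact hρ.ne this
  have hpoint : ∀ ρ θ, 0 < ρ → HasDerivAt (fun ρ => ρ * B ρ * φ (ρ • circlePoint θ)) (D θ ρ) ρ := by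
    intro ρ θ hρ
    have h1 : HasFDerivAt φ (fderiv ℝ φ (ρ • circlePoint θ)) (ρ • circlePoint θ) :=
      ((hφ.contDiffAt (isOpen_compl_singleton.mem_nhds (hne θ hρ))).differentiableAt
        (by norm_num)).hasFDerivAt
    have h2 : HasDerivAt (fun ρ : ℝ => ρ • circlePoint θ) (circlePoint θ) ρ := by
      simpa using (hasDerivAt_id ρ).smul_const (circlePoint θ)
    have h3 : HasDerivAt (fun ρ : ℝ => φ (ρ • circlePoint θ))
        (fderiv ℝ φ (ρ • circlePoint θ) (circlePoint θ)) ρ := h1.comp_hasDerivAt ρ h2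
    refine (((hasDerivAt_id ρ).fun_mul (hB ρ hρ)).fun_mul h3).congr_deriv ?_
    simp only [hD, id]
    ring
  have hcont : ContinuousOn (fun p : ℝ × ℝ => D p.2 p.1) (Set.Ioi 0 ×ˢ Set.univ) := by
    have hcB : ContinuousOn B (Set.Ioi 0) := fun ρ hρ => (hB ρ hρ).continuousAt.continuousWithinAt
    have hfst : ContinuousOn (fun p : ℝ × ℝ => p.1) (Set.Ioi 0 ×ˢ Set.univ) :=
      continuousOn_fst
    have hm1 : Set.MapsTo (fun p : ℝ × ℝ => p.1) (Set.Ioi 0 ×ˢ Set.univ) (Set.Ioi 0) :=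
      fun p hp => hp.1
    have hc : Continuous fun p : ℝ × ℝ => p.1 • circlePoint p.2 :=
      continuous_fst.smul (continuous_circlePoint.comp continuous_snd)
    have hm2 : Set.MapsTo (fun p : ℝ × ℝ => p.1 • circlePoint p.2) (Set.Ioi 0 ×ˢ Set.univ)
        ({0}ᶜ : Set Plane) := fun p hp => hne p.2 hp.1
    have hfd : ContinuousOn (fderiv ℝ φ) {0}ᶜ :=
      hφ.continuousOn_fderiv_of_isOpen isOpen_compl_singleton le_rfl
    exact (((hfst.mul (hB'.comp hfst hm1)).add (hcB.comp hfst hm1)).mul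
      (hφ.continuousOn.comp hc.continuousOn hm2)).add
      ((hfst.mul (hcB.comp hfst hm1)).mul ((hfd.comp hc.continuousOn hm2).clm_apply
        (continuous_circlePoint.comp continuous_snd).continuousOn))
  have hint : IntegrableOn (fun p : ℝ × ℝ => D p.2 p.1)
      (Set.Ioo a b ×ˢ Set.Ioo (-Real.pi) Real.pi) (volume.prod volume) := by
    have hK : IsCompact (Set.Icc a b ×ˢ Set.Icc (-Real.pi) Real.pi) := isCompact_Icc.prod isCompact_Icc
    refine IntegrableOn.mono_set ((hcont.mono ?_).integrableOn_compact hK)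
      (Set.prod_mono Set.Ioo_subset_Icc_self Set.Ioo_subset_Icc_self)
    exact Set.prod_mono (fun ρ hρ => lt_of_lt_of_le ha hρ.1) (Set.subset_univ _)
  have hftc : ∀ θ, ∫ ρ in Set.Ioo a b, D θ ρ =
      b * B b * φ (b • circlePoint θ) - a * B a * φ (a • circlePoint θ) := fun θ => by
    have hsub : Set.uIcc a b ⊆ Set.Ioi 0 := fun ρ hρ => by
      rw [Set.uIcc_of_le hab.le] at hρ
      exact lt_of_lt_of_le ha hρ.1
    rw [← integral_Ioc_eq_integral_Ioo, ← intervalIntegral.integral_of_le hab.le]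
    refine intervalIntegral.integral_eq_sub_of_hasDerivAt
      (f := fun ρ => ρ * B ρ * φ (ρ • circlePoint θ)) (fun ρ hρ => hpoint ρ θ (hsub hρ)) ?_
    refine ContinuousOn.intervalIntegrable (hcont.comp (f := fun ρ : ℝ => (ρ, θ))
      (by fun_prop) fun ρ hρ => ⟨hsub hρ, trivial⟩)
  have hic : ∀ c : ℝ, 0 < c → IntegrableOn (fun θ => c * B c * φ (c • circlePoint θ))
      (Set.Ioo (-Real.pi) Real.pi) := fun c hc => by
    have h : Continuous fun θ => c * B c * φ (c • circlePoint θ) :=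
      continuous_const.mul (hφ.continuousOn.comp_continuous
        (continuous_circlePoint.const_smul c) fun θ => hne θ hc)
    exact (h.continuousOn.integrableOn_compact isCompact_Icc).mono_set Set.Ioo_subset_Icc_self
  have hval : ∀ ρ θ, 0 < ρ → ρ * ((B' ‖ρ • circlePoint θ‖ + B ‖ρ • circlePoint θ‖ /
      ‖ρ • circlePoint θ‖) * φ (ρ • circlePoint θ) + B ‖ρ • circlePoint θ‖ / ‖ρ • circlePoint θ‖ *
      fderiv ℝ φ (ρ • circlePoint θ) (ρ • circlePoint θ)) = D θ ρ := fun ρ θ hρ => by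
    simp only [hD, norm_smul_circlePoint hρ.le, map_smul, smul_eq_mul]
    field_simp
  rw [integral_annulus_polar ha.le, ← integral_sub (hic b (ha.trans hab)) (hic a ha)]
  simp only [← hftc]
  rw [Measure.volume_eq_prod, ← setIntegral_prod_swap, setIntegral_prod]
  · refine setIntegral_congr_fun measurableSet_Ioo fun θ _ => ?_
    exact setIntegral_congr_fun measurableSet_Ioo fun ρ hρ => hval ρ θ (ha.trans hρ.1)
  · exact hint.swap.congr_fun (fun p hp => (hval p.2 p.1 (ha.trans hp.2.1)).symm)
      (measurableSet_Ioo.prod measurableSet_Ioo)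

/-! ### Weak derivatives of Lipschitz functions -/

lemma measurable_gradient (u : Plane → ℝ) : Measurable (∇ u) :=
  (InnerProductSpace.toDual ℝ Plane).symm.continuous.measurable.comp (measurable_fderiv ℝ u)

lemma norm_gradient (u : Plane → ℝ) (x : Plane) : ‖∇ u x‖ = ‖fderiv ℝ u x‖ :=
  (InnerProductSpace.toDual ℝ Plane).symm.norm_map _

lemma norm_gradient_le {u : Plane → ℝ} {C : NNReal} (hu : LipschitzWith C u) (x : Plane) :
    ‖∇ u x‖ ≤ C := by
  rw [norm_gradient]
  exact norm_fderiv_le_of_lipschitz ℝ hu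

lemma sum_gradient_mul (φ : Plane → ℝ) (x : Plane) :
    ∑ i : Fin 2, x i * ∇ φ x i = fderiv ℝ φ x x := by
  have h := inner_gradient_left (𝕜 := ℝ) (f := φ) (x := x) (y := x)
  rw [← h, PiLp.inner_apply]
  simp

/-- By Rademacher's theorem the pointwise gradient exists almost everywhere, and it is the weak
gradient. Kinks thus need no separate treatment. -/
lemma integral_lipschitz_mul_gradient {u ψ : Plane → ℝ} {C : NNReal} (hu : LipschitzWith C u)
    (hψ : ContDiff ℝ 1 ψ) (hs : HasCompactSupport ψ) (i : Fin 2) :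
    ∫ x, u x * ∇ ψ x i = -∫ x, ∇ u x i * ψ x := by
  obtain ⟨D, hD⟩ := hψ.lipschitzWith_of_hasCompactSupport hs (by norm_num)
  have h := hu.integral_lineDeriv_mul_eq (μ := volume) hD hs (EuclideanSpace.single i (1 : ℝ))
  have h1 : ∫ x, lineDeriv ℝ u x (EuclideanSpace.single i (1 : ℝ)) * ψ x =
      ∫ x, ∇ u x i * ψ x := by
    refine integral_congr_ae ?_
    filter_upwards [hu.ae_differentiableAt] with x hx
    rw [hx.lineDeriv_eq_fderiv, gradient_apply]
  rw [← h1, h, ← integral_neg]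
  refine integral_congr_ae (Eventually.of_forall fun x => ?_)
  simp only
  rw [(hψ.differentiable (by norm_num) x).lineDeriv_eq_fderiv, gradient_apply, map_neg]
  ring

lemma gradient_eq_zero_of_notMem_tsupport {ψ : Plane → ℝ} {x : Plane} (hx : x ∉ tsupport ψ) :
    ∇ ψ x = 0 := by
  have : fderiv ℝ ψ x = 0 := by
    by_contra h
    exact hx (support_fderiv_subset ℝ h)
  rw [gradient, this, map_zero]

lemma setIntegral_lipschitz_mul_gradient {u ψ : Plane → ℝ} {C : NNReal} (hu : LipschitzWith C u)
    (hψ : ContDiff ℝ 1 ψ) (hs : HasCompactSupport ψ) {Ω : Set Plane} (hΩ : tsupport ψ ⊆ Ω)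
    (i : Fin 2) : ∫ x in Ω, u x * ∇ ψ x i = -∫ x in Ω, ∇ u x i * ψ x := by
  rw [setIntegral_eq_integral_of_forall_compl_eq_zero fun x hx => ?_,
    setIntegral_eq_integral_of_forall_compl_eq_zero fun x hx => ?_,
    integral_lipschitz_mul_gradient hu hψ hs]
  · rw [image_eq_zero_of_notMem_tsupport fun h => hx (hΩ h), mul_zero]
  · rw [gradient_eq_zero_of_notMem_tsupport fun h => hx (hΩ h)]
    simp

/-! ### Piecewise radial functions -/

/-- Clamping to a compact interval in `(0, ∞)` bounds the derivative and avoids the singularity at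
zero, giving a globally Lipschitz function. -/
lemma exists_lipschitzWith_comp_clamp {A A' : ℝ → ℝ} {a b : ℝ} (ha : 0 < a) (hab : a ≤ b)
    (hA : ∀ ρ, 0 < ρ → HasDerivAt A (A' ρ) ρ) (hA' : ContinuousOn A' (Set.Ioi 0)) :
    ∃ K, LipschitzWith K fun ρ => A (max a (min b ρ)) := by
  have hsub : Set.Icc a b ⊆ Set.Ioi 0 := fun ρ hρ => lt_of_lt_of_le ha hρ.1
  obtain ⟨C, hC⟩ := isCompact_Icc.exists_bound_of_continuousOn (hA'.mono hsub)
  have h1 : LipschitzOnWith C.toNNReal A (Set.Icc a b) :=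
    (convex_Icc a b).lipschitzOnWith_of_nnnorm_hasDerivWithin_le
      (fun ρ hρ => (hA ρ (hsub hρ)).hasDerivWithinAt) fun ρ hρ => by
        rw [← NNReal.coe_le_coe, coe_nnnorm]
        exact (hC ρ hρ).trans (Real.le_coe_toNNReal C)
  have h2 : LipschitzWith 1 fun ρ : ℝ => max a (min b ρ) :=
    (LipschitzWith.id.const_min b).const_max a
  refine ⟨C.toNNReal * 1, ?_⟩
  rw [← lipschitzOnWith_univ] at h2 ⊢
  exact h1.comp h2 fun ρ _ => ⟨le_max_left _ _, max_le hab (min_le_left _ _)⟩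

/-- The function equal to `A₁` on `[a, m]` and to `A₂` on `[m, c]` (if `A₁ m = A₂ m`), extended
by constants. -/
noncomputable def clampGlue (a m c : ℝ) (A₁ A₂ : ℝ → ℝ) (ρ : ℝ) : ℝ :=
  A₁ (max a (min m ρ)) + A₂ (max m (min c ρ)) - A₂ m

section clampGlue

variable {a m c : ℝ} {A₁ A₂ A₁' A₂' : ℝ → ℝ}

lemma clampGlue_of_le_left (ham : a ≤ m) (hmc : m ≤ c) {ρ : ℝ} (hρ : ρ ≤ a) :
    clampGlue a m c A₁ A₂ ρ = A₁ a := by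
  rw [clampGlue, min_eq_right (hρ.trans ham), max_eq_left hρ,
    min_eq_right ((hρ.trans ham).trans hmc), max_eq_left (hρ.trans ham), add_sub_cancel_right]

lemma clampGlue_left (hmc : m ≤ c) {ρ : ℝ} (h1 : a ≤ ρ) (h2 : ρ ≤ m) :
    clampGlue a m c A₁ A₂ ρ = A₁ ρ := by
  rw [clampGlue, min_eq_right h2, max_eq_right h1, min_eq_right (h2.trans hmc), max_eq_left h2,
    add_sub_cancel_right]

lemma clampGlue_right (h : A₁ m = A₂ m) (ham : a ≤ m) {ρ : ℝ} (h1 : m ≤ ρ) (h2 : ρ ≤ c) :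
    clampGlue a m c A₁ A₂ ρ = A₂ ρ := by
  rw [clampGlue, min_eq_left h1, max_eq_right ham, min_eq_right h2, max_eq_right h1, h]
  ring

lemma clampGlue_of_le_right (h : A₁ m = A₂ m) (ham : a ≤ m) (hmc : m ≤ c) {ρ : ℝ} (hρ : c ≤ ρ) :
    clampGlue a m c A₁ A₂ ρ = A₂ c := by
  rw [clampGlue, min_eq_left (hmc.trans hρ), max_eq_right ham, min_eq_left hρ, max_eq_right hmc, h]
  ring

lemma exists_lipschitzWith_clampGlue (ha : 0 < a) (ham : a ≤ m) (hmc : m ≤ c)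
    (h₁ : ∀ ρ, 0 < ρ → HasDerivAt A₁ (A₁' ρ) ρ) (h₁' : ContinuousOn A₁' (Set.Ioi 0))
    (h₂ : ∀ ρ, 0 < ρ → HasDerivAt A₂ (A₂' ρ) ρ) (h₂' : ContinuousOn A₂' (Set.Ioi 0)) :
    ∃ K, LipschitzWith K fun x : Plane => clampGlue a m c A₁ A₂ ‖x‖ := by
  obtain ⟨K₁, hK₁⟩ := exists_lipschitzWith_comp_clamp ha ham h₁ h₁'
  obtain ⟨K₂, hK₂⟩ := exists_lipschitzWith_comp_clamp (ha.trans_le ham) hmc h₂ h₂'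
  exact ⟨_, ((hK₁.add hK₂).sub (LipschitzWith.const (A₂ m))).comp lipschitzWith_one_norm⟩

lemma gradient_clampGlue_left (ha : 0 < a) (hmc : m ≤ c)
    (h₁ : ∀ ρ, 0 < ρ → HasDerivAt A₁ (A₁' ρ) ρ) {x : Plane} (hx : x ∈ annulus a m) :
    ∇ (fun y : Plane => clampGlue a m c A₁ A₂ ‖y‖) x = (A₁' ‖x‖ / ‖x‖) • x := by
  rw [mem_annulus] at hx
  have h0 := ha.trans hx.1
  refine gradient_radial (norm_pos_iff.1 h0) ((h₁ _ h0).congr_of_eventuallyEq ?_)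
  filter_upwards [Ioo_mem_nhds hx.1 hx.2] with ρ hρ using clampGlue_left hmc hρ.1.le hρ.2.le

lemma gradient_clampGlue_right (ha : 0 < a) (ham : a ≤ m) (h : A₁ m = A₂ m)
    (h₂ : ∀ ρ, 0 < ρ → HasDerivAt A₂ (A₂' ρ) ρ) {x : Plane} (hx : x ∈ annulus m c) :
    ∇ (fun y : Plane => clampGlue a m c A₁ A₂ ‖y‖) x = (A₂' ‖x‖ / ‖x‖) • x := by
  rw [mem_annulus] at hx
  have h0 := (ha.trans_le ham).trans hx.1
  refine gradient_radial (norm_pos_iff.1 h0) ((h₂ _ h0).congr_of_eventuallyEq ?_)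
  filter_upwards [Ioo_mem_nhds hx.1 hx.2] with ρ hρ using clampGlue_right h ham hρ.1.le hρ.2.le

end clampGlue

lemma isFiniteMeasure_restrict_annulus (a b : ℝ) :
    IsFiniteMeasure (volume.restrict (annulus a b : Set Plane)) :=
  ⟨by
    rw [Measure.restrict_apply_univ]
    exact (measure_mono Set.sdiff_subset).trans_lt (measure_ball_lt_top (x := (0 : Plane)) (r := b))⟩

lemma ae_norm_ne (c : ℝ) : ∀ᵐ x : Plane, ‖x‖ ≠ c := by
  rw [ae_iff]
  convert Measure.addHaar_sphere (volume : Measure Plane) 0 c using 2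
  ext x
  simp

lemma setIntegral_annulus_split {a m c : ℝ} (ham : a ≤ m) (hmc : m ≤ c) {G : Plane → ℝ}
    (hG : IntegrableOn G (annulus a c)) :
    ∫ x in annulus a c, G x = (∫ x in annulus a m, G x) + ∫ x in annulus m c, G x := by
  have hs1 : (annulus a m : Set Plane) ⊆ annulus a c := fun x hx => by
    rw [SetLike.mem_coe, mem_annulus] at hx ⊢
    exact ⟨hx.1, hx.2.trans_le hmc⟩
  have hs2 : (annulus m c : Set Plane) ⊆ annulus a c := fun x hx => by
    rw [SetLike.mem_coe, mem_annulus] at hx ⊢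
    exact ⟨ham.trans_lt hx.1, hx.2⟩
  have hdisj : Disjoint (annulus a m : Set Plane) (annulus m c) := by
    rw [Set.disjoint_left]
    intro x hx hx'
    rw [SetLike.mem_coe, mem_annulus] at hx hx'
    exact lt_asymm hx.2 hx'.1
  rw [← setIntegral_union hdisj (annulus m c).isOpen.measurableSet (hG.mono_set hs1)
    (hG.mono_set hs2)]
  refine setIntegral_congr_set ?_
  filter_upwards [ae_norm_ne m] with x hx
  refine propext ⟨fun h => ?_, fun h => h.elim (fun h => hs1 h) fun h => hs2 h⟩
  have h' := mem_annulus.1 h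
  rcases lt_or_gt_of_ne hx with h1 | h1
  · exact Or.inl (mem_annulus.2 ⟨h'.1, h1⟩)
  · exact Or.inr (mem_annulus.2 ⟨h1, h'.2⟩)

lemma integrableOn_annulus_of_bound {a b : ℝ} {u ψ : Plane → ℝ} {C : ℝ} (hu : Measurable u)
    (hC : ∀ x, ‖u x‖ ≤ C) (hψ : Continuous ψ) (hs : HasCompactSupport ψ) :
    IntegrableOn (fun x => u x * ψ x) (annulus a b) :=
  ((hψ.integrable_of_hasCompactSupport hs).bdd_mul (c := C) hu.aestronglyMeasurable
    (Eventually.of_forall hC)).integrableOn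

/-! ### The glued solution -/

/-- Radii and coefficients for which the two radial solutions have opposite derivatives on the
circle of radius `2`. -/
structure GluingData where
  /-- the inner radius -/
  r : ℝ
  /-- the outer radius -/
  R : ℝ
  /-- the derivative at `2` -/
  d : ℝ
  /-- the common first coefficient -/
  α : ℝ
  /-- the second coefficient of the inner solution -/
  β₁ : ℝ
  /-- the second coefficient of the outer solution -/
  β₂ : ℝ
  r_pos : 0 < r
  r_lt : r < 2
  lt_R : 2 < R
  d_pos : 0 < d
  β₁_pos : 0 < β₁
  β₂_neg : β₂ < 0
  inner_r : radialSol α β₁ r = 0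
  inner_two : radialSol α β₁ 2 = 1
  outer_two : radialSol α β₂ 2 = 1
  outer_R : radialSol α β₂ R = 0
  inner_deriv : radialSol' α β₁ 2 = d
  outer_deriv : radialSol' α β₂ 2 = -d

/-- As `J(2) = 0`, the value 1 at radius 2 fixes `α` whatever `β` is, and the slopes `±d` then fix
`β₁` and `β₂`. For `d` large the solutions are negative at 1 and at 3, and the intermediate value
theorem supplies `r` and `R`. -/
lemma nonempty_gluingData : Nonempty GluingData := by
  have hI := besselI_pos 2
  have hJ1 : besselQuot 1 < 0 := by
    rw [← besselQuot_two]
    exact strictMonoOn_besselQuot (Set.mem_Ioi.2 one_pos) (Set.mem_Ioi.2 two_pos) one_lt_two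
  have hJ3 : 0 < besselQuot 3 := by
    rw [← besselQuot_two]
    exact strictMonoOn_besselQuot (Set.mem_Ioi.2 two_pos) (Set.mem_Ioi.2 three_pos) (by norm_num)
  set α := 1 / besselI 2 with hα
  have hα0 : 0 < α := by positivity
  have hIα : besselI 2 * α = 1 := mul_one_div_cancel hI.ne'
  -- Negativity of `α + β J` at 1 needs `β > α/(-J(1))`, and at 3 it needs `-β > α/J(3)`; the sum
  -- dominates both thresholds.
  set N := α / -besselQuot 1 + α / besselQuot 3 with hN
  have hN1 : 0 < α / -besselQuot 1 := div_pos hα0 (by linarith)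
  have hN3 : 0 < α / besselQuot 3 := div_pos hα0 hJ3
  -- The slope at 2 is `(2 I'(2) + β)/(2 I(2))`. This `d` gives `β₁ ≥ 2N` and `β₂ ≤ -2N`, whatever
  -- the sign of `I'(2)`.
  set d := (|besselI' 2| + N) / besselI 2 with hd
  have hd0 : 0 < d := div_pos (by positivity) hI
  have hdI : d * besselI 2 = |besselI' 2| + N := div_mul_cancel₀ _ hI.ne'
  set β₁ := 2 * (d * besselI 2) - 2 * besselI' 2 with hβ₁
  set β₂ := -(2 * (d * besselI 2)) - 2 * besselI' 2 with hβ₂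
  have h1 : N < β₁ := by
    have := le_abs_self (besselI' 2)
    linarith
  have h2 : β₂ < -N := by
    have := neg_abs_le (besselI' 2)
    linarith
  have hval : ∀ β, radialSol α β 2 = 1 := fun β => by
    rw [radialSol, besselQuot_two, mul_zero, add_zero, hIα]
  have hneg1 : radialSol α β₁ 1 < 0 := by
    refine mul_neg_of_pos_of_neg (besselI_pos 1) ?_
    have : α < β₁ * -besselQuot 1 := by
      rw [← div_lt_iff₀ (by linarith)]
      linarith
    linarith
  have hneg3 : radialSol α β₂ 3 < 0 := by
    refine mul_neg_of_pos_of_neg (besselI_pos 3) ?_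
    have : α < -β₂ * besselQuot 3 := by
      rw [← div_lt_iff₀ hJ3]
      linarith
    linarith
  have hcont : ∀ β a b, 0 < a → ContinuousOn (radialSol α β) (Set.Icc a b) := fun β a b ha =>
    (contDiffOn_radialSol α β).continuousOn.mono fun ρ hρ => lt_of_lt_of_le ha hρ.1
  obtain ⟨r, hr, hr0⟩ := intermediate_value_Icc (one_le_two (α := ℝ)) (hcont β₁ 1 2 one_pos)
    (show (0 : ℝ) ∈ Set.Icc _ _ from ⟨hneg1.le, (hval β₁).symm ▸ zero_le_one⟩)
  obtain ⟨R, hR, hR0⟩ := intermediate_value_Icc' (by norm_num : (2 : ℝ) ≤ 3)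
    (hcont β₂ 2 3 two_pos)
    (show (0 : ℝ) ∈ Set.Icc _ _ from ⟨hneg3.le, (hval β₂).symm ▸ zero_le_one⟩)
  have hderiv : ∀ β, radialSol' α β 2 = (2 * besselI' 2 + β) / (2 * besselI 2) := fun β => by
    rw [radialSol', besselQuot_two, hα]
    field_simp
    ring
  exact ⟨{
    r := r, R := R, d := d, α := α, β₁ := β₁, β₂ := β₂
    r_pos := by linarith [hr.1]
    r_lt := lt_of_le_of_ne hr.2 fun h => by
      rw [h, hval] at hr0
      exact one_ne_zero hr0
    lt_R := lt_of_le_of_ne hR.1 fun h => by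
      rw [← h, hval] at hR0
      exact one_ne_zero hR0
    d_pos := hd0
    β₁_pos := by linarith
    β₂_neg := by linarith
    inner_r := hr0
    inner_two := hval β₁
    outer_two := hval β₂
    outer_R := hR0
    inner_deriv := by
      rw [hderiv, hβ₁]
      field_simp
      ring
    outer_deriv := by
      rw [hderiv, hβ₂]
      field_simp
      ring }⟩

namespace GluingData

variable (S : GluingData)

/-- The radial profile of the inner solution. -/
noncomputable def inner : ℝ → ℝ := radialSol S.α S.β₁

/-- The derivative of the inner profile. -/
noncomputable def inner' : ℝ → ℝ := radialSol' S.α S.β₁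

/-- The radial profile of the outer solution. -/
noncomputable def outer : ℝ → ℝ := radialSol S.α S.β₂

/-- The derivative of the outer profile. -/
noncomputable def outer' : ℝ → ℝ := radialSol' S.α S.β₂

/-- The radial profile of the glued solution. -/
noncomputable def profile : ℝ → ℝ := clampGlue S.r 2 S.R S.inner S.outer

/-- The glued solution. -/
noncomputable def sol (x : Plane) : ℝ := S.profile ‖x‖

lemma r_lt_R : S.r < S.R := S.r_lt.trans S.lt_R

lemma R_pos : 0 < S.R := two_pos.trans S.lt_R

lemma hasDerivAt_inner : ∀ ρ, 0 < ρ → HasDerivAt S.inner (S.inner' ρ) ρ :=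
  fun _ => hasDerivAt_radialSol S.α S.β₁

lemma hasDerivAt_outer : ∀ ρ, 0 < ρ → HasDerivAt S.outer (S.outer' ρ) ρ :=
  fun _ => hasDerivAt_radialSol S.α S.β₂

lemma hasDerivAt_inner' : ∀ ρ, 0 < ρ → HasDerivAt S.inner' (S.inner ρ - S.inner' ρ / ρ) ρ :=
  fun _ => hasDerivAt_radialSol' S.α S.β₁

lemma hasDerivAt_outer' : ∀ ρ, 0 < ρ → HasDerivAt S.outer' (S.outer ρ - S.outer' ρ / ρ) ρ :=
  fun _ => hasDerivAt_radialSol' S.α S.β₂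

lemma inner_eq_outer : S.inner 2 = S.outer 2 := S.inner_two.trans S.outer_two.symm

lemma profile_of_le_r {ρ : ℝ} (h : ρ ≤ S.r) : S.profile ρ = 0 :=
  (clampGlue_of_le_left S.r_lt.le S.lt_R.le h).trans S.inner_r

lemma profile_inner {ρ : ℝ} (h1 : S.r ≤ ρ) (h2 : ρ ≤ 2) : S.profile ρ = S.inner ρ :=
  clampGlue_left S.lt_R.le h1 h2

lemma profile_outer {ρ : ℝ} (h1 : 2 ≤ ρ) (h2 : ρ ≤ S.R) : S.profile ρ = S.outer ρ :=
  clampGlue_right S.inner_eq_outer S.r_lt.le h1 h2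

lemma profile_of_R_le {ρ : ℝ} (h : S.R ≤ ρ) : S.profile ρ = 0 :=
  (clampGlue_of_le_right S.inner_eq_outer S.r_lt.le S.lt_R.le h).trans S.outer_R

/-- On each side `α + β J` is strictly monotone and vanishes at the outer end of that side, `r` or
`R`, increasing towards radius 2. -/
lemma profile_pos {ρ : ℝ} (h1 : S.r < ρ) (h2 : ρ < S.R) : 0 < S.profile ρ := by
  have hr : (0 : ℝ) < S.r := S.r_pos
  have hρ0 : 0 < ρ := hr.trans h1
  rcases le_total ρ 2 with h | h
  · rw [S.profile_inner h1.le h]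
    refine mul_pos (besselI_pos ρ) ?_
    have h3 : S.α + S.β₁ * besselQuot S.r = 0 :=
      (mul_eq_zero.1 S.inner_r).resolve_left (besselI_pos _).ne'
    have h4 := mul_lt_mul_of_pos_left (strictMonoOn_besselQuot hr hρ0 h1) S.β₁_pos
    linarith
  · rw [S.profile_outer h h2.le]
    refine mul_pos (besselI_pos ρ) ?_
    have h3 : S.α + S.β₂ * besselQuot S.R = 0 :=
      (mul_eq_zero.1 S.outer_R).resolve_left (besselI_pos _).ne'
    have h4 := mul_lt_mul_of_neg_left (strictMonoOn_besselQuot hρ0 S.R_pos h2) S.β₂_neg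
    linarith

lemma inner_sub_outer (ρ : ℝ) :
    S.inner ρ - S.outer ρ = (S.β₁ - S.β₂) * besselI ρ * besselQuot ρ := by
  simp only [inner, outer, radialSol]
  ring

/-- The difference of the two solutions has the sign of `J`, hence of `ρ - 2`. A minimum can be
smoothed by a single formula valid on both sides of the kink. -/
lemma profile_eq_min {ρ : ℝ} (h1 : S.r ≤ ρ) (h2 : ρ ≤ S.R) :
    S.profile ρ = min (S.inner ρ) (S.outer ρ) := by
  have hρ0 : 0 < ρ := S.r_pos.trans_le h1
  have hc : 0 ≤ (S.β₁ - S.β₂) * besselI ρ :=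
    mul_nonneg (by linarith [S.β₁_pos, S.β₂_neg]) (besselI_pos ρ).le
  rcases le_total ρ 2 with h | h
  · rw [S.profile_inner h1 h, min_eq_left]
    have : besselQuot ρ ≤ 0 := by
      rw [← besselQuot_two]
      exact strictMonoOn_besselQuot.monotoneOn hρ0 (Set.mem_Ioi.2 two_pos) h
    linarith [S.inner_sub_outer ρ, mul_nonpos_of_nonneg_of_nonpos hc this]
  · rw [S.profile_outer h h2, min_eq_right]
    have : 0 ≤ besselQuot ρ := by
      rw [← besselQuot_two]
      exact strictMonoOn_besselQuot.monotoneOn (Set.mem_Ioi.2 two_pos) hρ0 h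
    linarith [S.inner_sub_outer ρ, mul_nonneg hc this]

lemma continuousOn_inner' : ContinuousOn S.inner' (Set.Ioi 0) := fun ρ hρ =>
  (S.hasDerivAt_inner' ρ hρ).continuousAt.continuousWithinAt

lemma continuousOn_outer' : ContinuousOn S.outer' (Set.Ioi 0) := fun ρ hρ =>
  (S.hasDerivAt_outer' ρ hρ).continuousAt.continuousWithinAt

lemma continuousOn_inner : ContinuousOn S.inner (Set.Ioi 0) := fun ρ hρ =>
  (S.hasDerivAt_inner ρ hρ).continuousAt.continuousWithinAt

lemma continuousOn_outer : ContinuousOn S.outer (Set.Ioi 0) := fun ρ hρ =>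
  (S.hasDerivAt_outer ρ hρ).continuousAt.continuousWithinAt

/-! ### Regularity and boundary behaviour of the glued function. -/

lemma exists_lipschitzWith_sol : ∃ K, LipschitzWith K S.sol :=
  exists_lipschitzWith_clampGlue S.r_pos S.r_lt.le S.lt_R.le S.hasDerivAt_inner
    S.continuousOn_inner' S.hasDerivAt_outer S.continuousOn_outer'

lemma continuous_sol : Continuous S.sol := S.exists_lipschitzWith_sol.choose_spec.continuous

lemma gradient_sol_inner {x : Plane} (hx : x ∈ annulus S.r 2) :
    ∇ S.sol x = (S.inner' ‖x‖ / ‖x‖) • x :=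
  gradient_clampGlue_left S.r_pos S.lt_R.le S.hasDerivAt_inner hx

lemma gradient_sol_outer {x : Plane} (hx : x ∈ annulus 2 S.R) :
    ∇ S.sol x = (S.outer' ‖x‖ / ‖x‖) • x :=
  gradient_clampGlue_right S.r_pos S.r_lt.le S.inner_eq_outer S.hasDerivAt_outer hx

/-- One global function solves both Dirichlet problems on their annuli, so it can serve as `h₁` and
as `h₂`. -/
lemma glue_sol : glue S.sol S.sol = S.sol := funext fun _ => ite_self _

lemma isDirichletSolution_inner : IsDirichletSolution S.r 2 0 1 S.sol :=
  isDirichletSolution_radialSol S.r_pos S.inner_r S.inner_two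
    (fun _ hx => S.profile_inner hx.1 hx.2) S.r_lt

lemma isDirichletSolution_outer : IsDirichletSolution 2 S.R 1 0 S.sol :=
  isDirichletSolution_radialSol two_pos S.outer_two S.outer_R
    (fun _ hx => S.profile_outer hx.1 hx.2) S.lt_R

lemma sol_smul {e : Plane} (he : ‖e‖ = 1) {ρ : ℝ} (hρ : 0 ≤ ρ) : S.sol (ρ • e) = S.profile ρ := by
  rw [sol, norm_smul, he, mul_one, Real.norm_of_nonneg hρ]

lemma hasDerivWithinAt_sol_inner {e : Plane} (he : ‖e‖ = 1) :
    HasDerivWithinAt (fun ρ : ℝ => S.sol (ρ • e)) S.d (Set.Iic 2) 2 := by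
  have h := (S.hasDerivAt_inner 2 two_pos).hasDerivWithinAt (s := Set.Iic 2)
  rw [show S.inner' 2 = S.d from S.inner_deriv] at h
  refine h.congr_of_eventuallyEq ?_ ?_
  · filter_upwards [self_mem_nhdsWithin, mem_nhdsWithin_of_mem_nhds (Ioi_mem_nhds S.r_lt)]
      with ρ h1 h2
    rw [S.sol_smul he (S.r_pos.trans h2).le, S.profile_inner (le_of_lt h2) h1]
  · rw [S.sol_smul he zero_le_two, S.profile_inner S.r_lt.le le_rfl]

lemma hasDerivWithinAt_sol_outer {e : Plane} (he : ‖e‖ = 1) :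
    HasDerivWithinAt (fun ρ : ℝ => S.sol (ρ • e)) (-S.d) (Set.Ici 2) 2 := by
  have h := (S.hasDerivAt_outer 2 two_pos).hasDerivWithinAt (s := Set.Ici 2)
  rw [show S.outer' 2 = -S.d from S.outer_deriv] at h
  refine h.congr_of_eventuallyEq ?_ ?_
  · filter_upwards [self_mem_nhdsWithin, mem_nhdsWithin_of_mem_nhds (Iio_mem_nhds S.lt_R)]
      with ρ h1 h2
    rw [S.sol_smul he (zero_le_two.trans h1), S.profile_outer h1 (le_of_lt h2)]
  · rw [S.sol_smul he zero_le_two, S.profile_outer le_rfl S.lt_R.le]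

lemma sol_eq_zero_of_mem_frontier {x : Plane}
    (hx : x ∈ frontier (annulus S.r S.R : Set Plane)) : S.sol x = 0 := by
  rcases norm_eq_of_mem_frontier_annulus hx with h | h
  · rw [sol, h, S.profile_of_le_r le_rfl]
  · rw [sol, h, S.profile_of_R_le le_rfl]

lemma not_ae_eq_zero : ¬ S.sol =ᵐ[volume.restrict (annulus S.r S.R : Set Plane)] 0 := by
  intro h
  have h1 : ∀ᵐ x ∂(volume.restrict (annulus S.r S.R : Set Plane)), False := by
    filter_upwards [h, ae_restrict_mem (annulus S.r S.R).isOpen.measurableSet] with x hx hm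
    rw [SetLike.mem_coe, mem_annulus] at hm
    exact (S.profile_pos hm.1 hm.2).ne' hx
  rw [ae_iff] at h1
  simp only [not_false_eq_true, Set.ofPred_true, Measure.restrict_apply_univ] at h1
  exact ((annulus S.r S.R).isOpen.measure_pos volume
    (isConnected_annulus S.r_pos S.r_lt_R).nonempty).ne' h1

lemma exists_bound_sol : ∃ C, ∀ x, ‖S.sol x‖ ≤ C := by
  have hs : HasCompactSupport S.sol :=
    HasCompactSupport.intro (isCompact_closedBall (0 : Plane) S.R) fun x hx =>
      S.profile_of_R_le (not_le.1 fun h => hx (mem_closedBall_zero_iff.2 h)).le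
  exact hs.exists_bound_of_continuous S.continuous_sol

lemma isH1_sol : IsH1 (annulus S.r S.R) S.sol (∇ S.sol) := by
  have := isFiniteMeasure_restrict_annulus S.r S.R
  obtain ⟨K, hK⟩ := S.exists_lipschitzWith_sol
  obtain ⟨C, hC⟩ := S.exists_bound_sol
  refine ⟨MemLp.of_bound S.continuous_sol.aestronglyMeasurable C (Eventually.of_forall hC),
    MemLp.of_bound (measurable_gradient _).aestronglyMeasurable K
      (Eventually.of_forall fun x => norm_gradient_le hK x), fun φ i => ?_⟩
  exact setIntegral_lipschitz_mul_gradient hK (φ.contDiff.of_le (by norm_cast))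
    φ.hasCompactSupport φ.tsupport_subset i

/-- Integration by parts in the radial direction on both annuli: the boundary terms on the outer
circles vanish, and those on the circle of radius `2` combine. -/
lemma integral_radial_by_parts_both {B₁ B₁' B₂ B₂' : ℝ → ℝ}
    (h₁ : ∀ ρ, 0 < ρ → HasDerivAt B₁ (B₁' ρ) ρ) (h₁' : ContinuousOn B₁' (Set.Ioi 0))
    (h₂ : ∀ ρ, 0 < ρ → HasDerivAt B₂ (B₂' ρ) ρ) (h₂' : ContinuousOn B₂' (Set.Ioi 0))
    {φ : Plane → ℝ} (hφ : ContDiffOn ℝ 1 φ {0}ᶜ) (h0 : ∀ x ∉ annulus S.r S.R, φ x = 0) :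
    (∫ x in annulus S.r 2,
        ((B₁' ‖x‖ + B₁ ‖x‖ / ‖x‖) * φ x + B₁ ‖x‖ / ‖x‖ * fderiv ℝ φ x x)) +
      (∫ x in annulus 2 S.R,
        ((B₂' ‖x‖ + B₂ ‖x‖ / ‖x‖) * φ x + B₂ ‖x‖ / ‖x‖ * fderiv ℝ φ x x)) =
      2 * (B₁ 2 - B₂ 2) *
        ∫ θ in Set.Ioo (-Real.pi) Real.pi, φ ((2 : ℝ) • circlePoint θ) := by
  have hr : ∀ θ, φ (S.r • circlePoint θ) = 0 := fun θ => h0 _ fun h => by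
    rw [mem_annulus, norm_smul_circlePoint S.r_pos.le] at h
    exact lt_irrefl _ h.1
  have hR : ∀ θ, φ (S.R • circlePoint θ) = 0 := fun θ => h0 _ fun h => by
    rw [mem_annulus, norm_smul_circlePoint S.R_pos.le] at h
    exact lt_irrefl _ h.2
  -- The factor 2 in the result is the radius of the middle circle, coming from the polar Jacobian.
  rw [integral_radial_by_parts S.r_pos S.r_lt h₁ h₁' hφ,
    integral_radial_by_parts two_pos S.lt_R h₂ h₂' hφ]
  simp only [hr, hR, mul_zero, integral_zero, integral_const_mul]
  ring

lemma eq_zero_of_notMem (φ : 𝓓(annulus S.r S.R, ℝ)) {x : Plane} (hx : x ∉ annulus S.r S.R) :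
    φ x = 0 :=
  image_eq_zero_of_notMem_tsupport fun h => hx (φ.tsupport_subset h)

lemma contDiff_one (φ : 𝓓(annulus S.r S.R, ℝ)) : ContDiff ℝ 1 φ :=
  φ.contDiff.of_le (by norm_cast)

lemma contDiff_gradient_apply (φ : 𝓓(annulus S.r S.R, ℝ)) (i : Fin 2) :
    ContDiff ℝ 1 fun x => ∇ φ x i := by
  simp only [gradient_apply]
  exact (φ.contDiff.fderiv_right (m := 1) (by norm_cast)).clm_apply contDiff_const

lemma tsupport_gradient_apply_subset (φ : 𝓓(annulus S.r S.R, ℝ)) (i : Fin 2) :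
    tsupport (fun x => ∇ φ x i) ⊆ tsupport φ := by
  refine closure_minimal (fun x hx => ?_) (isClosed_tsupport _)
  by_contra h
  exact hx (congrArg (fun v : Plane => v i) (gradient_eq_zero_of_notMem_tsupport h))

lemma hasCompactSupport_gradient_apply (φ : 𝓓(annulus S.r S.R, ℝ)) (i : Fin 2) :
    HasCompactSupport fun x => ∇ φ x i :=
  φ.hasCompactSupport.of_isClosed_subset (isClosed_tsupport _)
    (S.tsupport_gradient_apply_subset φ i)

lemma measurable_gradient_sol_apply (i : Fin 2) : Measurable fun x => ∇ S.sol x i :=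
  (EuclideanSpace.proj i : Plane →L[ℝ] ℝ).continuous.measurable.comp (measurable_gradient S.sol)

lemma exists_bound_gradient_sol : ∃ C, ∀ x, ‖∇ S.sol x‖ ≤ C := by
  obtain ⟨K, hK⟩ := S.exists_lipschitzWith_sol
  exact ⟨K, norm_gradient_le hK⟩

/-- One integration by parts gives the weak form `∫ ∇h·∇φ + hφ`; a radial one with `B = f'` then
leaves only the middle circle. There `2 (d - (-d)) ∫ φ dθ` equals `2d ∫ φ dH¹`, because `dH¹ = 2
dθ`. -/
lemma solvesHelmholtz_sol :
    SolvesHelmholtz (annulus S.r S.R) S.sol (circleMeasure (2 * S.d)) := by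
  intro φ
  obtain ⟨K, hK⟩ := S.exists_lipschitzWith_sol
  obtain ⟨C, hC⟩ := S.exists_bound_sol
  have hlap : ∀ x, (Δ (φ : Plane → ℝ)) x = ∑ i : Fin 2, ∇ (fun y => ∇ φ y i) x i := fun x => by
    rw [laplacian_eq_sum (φ.contDiff.of_le (by norm_cast)).contDiffAt]
    simp only [gradient_apply]
  have hi1 : ∀ i, IntegrableOn (fun x => S.sol x * ∇ (fun y => ∇ φ y i) x i)
      (annulus S.r S.R) := fun i => by
    refine integrableOn_annulus_of_bound S.continuous_sol.measurable hC ?_ ?_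
    · simp only [gradient_apply]
      exact ((φ.contDiff.fderiv_right (m := 1) (by norm_cast)).clm_apply
        contDiff_const).continuous_fderiv (by norm_num) |>.clm_apply continuous_const
    · refine (S.hasCompactSupport_gradient_apply φ i).mono' fun x hx => ?_
      by_contra h
      exact hx (congrArg (fun v : Plane => v i) (gradient_eq_zero_of_notMem_tsupport h))
  have hi2 : IntegrableOn (fun x => S.sol x * φ x) (annulus S.r S.R) :=
    integrableOn_annulus_of_bound S.continuous_sol.measurable hC φ.continuous φ.hasCompactSupport
  have hi3 : ∀ i, IntegrableOn (fun x => ∇ S.sol x i * ∇ φ x i) (annulus S.r S.R) := fun i =>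
    integrableOn_annulus_of_bound (S.measurable_gradient_sol_apply i)
      (fun x => (PiLp.norm_apply_le (∇ S.sol x) i).trans (norm_gradient_le hK x))
      (S.contDiff_gradient_apply φ i).continuous (S.hasCompactSupport_gradient_apply φ i)
  have hi4 : IntegrableOn (fun x => ∑ i : Fin 2, ∇ S.sol x i * ∇ φ x i) (annulus S.r S.R) :=
    integrable_finsetSum _ fun i _ => hi3 i
  have hi5 : IntegrableOn (fun x => ∑ i : Fin 2, ∇ S.sol x i * ∇ φ x i + S.sol x * φ x)
      (annulus S.r S.R) := hi4.add hi2
  have hi6 : IntegrableOn (fun x => -∑ i : Fin 2, S.sol x * ∇ (fun y => ∇ φ y i) x i)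
      (annulus S.r S.R) := (integrable_finsetSum _ fun i _ => hi1 i).neg
  have h1 : ∫ x in annulus S.r S.R, S.sol x * (-(Δ (φ : Plane → ℝ)) x + φ x) =
      ∫ x in annulus S.r S.R, (∑ i : Fin 2, ∇ S.sol x i * ∇ φ x i + S.sol x * φ x) := by
    have e : ∀ x, S.sol x * (-(Δ (φ : Plane → ℝ)) x + φ x) =
        -(∑ i : Fin 2, S.sol x * ∇ (fun y => ∇ φ y i) x i) + S.sol x * φ x := fun x => by
      rw [hlap, ← Finset.mul_sum]
      ring
    simp only [e]
    rw [integral_add hi6 hi2, integral_add hi4 hi2, integral_neg,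
      integral_finsetSum _ fun i _ => hi1 i, integral_finsetSum _ fun i _ => hi3 i,
      ← Finset.sum_neg_distrib]
    congr 1
    refine Finset.sum_congr rfl fun i _ => ?_
    rw [setIntegral_lipschitz_mul_gradient hK (S.contDiff_gradient_apply φ i)
      (S.hasCompactSupport_gradient_apply φ i)
      ((S.tsupport_gradient_apply_subset φ i).trans φ.tsupport_subset), neg_neg]
  -- The coefficient of `φ` is left uncancelled to display it as `B' + B/ρ` with `B = f'`.
  have h2 : ∫ x in annulus S.r 2, (∑ i : Fin 2, ∇ S.sol x i * ∇ φ x i + S.sol x * φ x) =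
      ∫ x in annulus S.r 2, ((S.inner ‖x‖ - S.inner' ‖x‖ / ‖x‖ + S.inner' ‖x‖ / ‖x‖) * φ x +
        S.inner' ‖x‖ / ‖x‖ * fderiv ℝ φ x x) := by
    refine setIntegral_congr_fun (annulus S.r 2).isOpen.measurableSet fun x hx => ?_
    have hx' := mem_annulus.1 hx
    simp only [S.gradient_sol_inner hx, PiLp.smul_apply, smul_eq_mul, mul_assoc, ← Finset.mul_sum,
      sum_gradient_mul, sol, S.profile_inner hx'.1.le hx'.2.le]
    ring
  have h3 : ∫ x in annulus 2 S.R, (∑ i : Fin 2, ∇ S.sol x i * ∇ φ x i + S.sol x * φ x) =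
      ∫ x in annulus 2 S.R, ((S.outer ‖x‖ - S.outer' ‖x‖ / ‖x‖ + S.outer' ‖x‖ / ‖x‖) * φ x +
        S.outer' ‖x‖ / ‖x‖ * fderiv ℝ φ x x) := by
    refine setIntegral_congr_fun (annulus 2 S.R).isOpen.measurableSet fun x hx => ?_
    have hx' := mem_annulus.1 hx
    simp only [S.gradient_sol_outer hx, PiLp.smul_apply, smul_eq_mul, mul_assoc, ← Finset.mul_sum,
      sum_gradient_mul, sol, S.profile_outer hx'.1.le hx'.2.le]
    ring
  have hid : ContinuousOn (fun ρ : ℝ => ρ) (Set.Ioi 0) := continuousOn_id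
  have hd1 : S.inner' 2 = S.d := S.inner_deriv
  have hd2 : S.outer' 2 = -S.d := S.outer_deriv
  rw [h1, setIntegral_annulus_split S.r_lt.le S.lt_R.le hi5, h2, h3,
    S.integral_radial_by_parts_both S.hasDerivAt_inner'
      (S.continuousOn_inner.sub (S.continuousOn_inner'.div hid fun _ h => ne_of_gt h))
      S.hasDerivAt_outer'
      (S.continuousOn_outer.sub (S.continuousOn_outer'.div hid fun _ h => ne_of_gt h))
      (S.contDiff_one φ).contDiffOn (fun x hx => S.eq_zero_of_notMem φ hx), hd1, hd2,
    setIntegral_eq_integral_of_forall_compl_eq_zero fun x hx => S.eq_zero_of_notMem φ hx,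
    circleMeasure_eq, integral_smul_measure, integral_circle φ φ.continuous, smul_eq_mul,
    ENNReal.toReal_ofReal (by linarith [S.d_pos])]
  ring

/-- The radial profile of `|∇h|² + h²`. -/
noncomputable def energy : ℝ → ℝ :=
  clampGlue S.r 2 S.R (fun ρ => S.inner' ρ ^ 2 + S.inner ρ ^ 2)
    fun ρ => S.outer' ρ ^ 2 + S.outer ρ ^ 2

lemma hasDerivAt_energy_aux {f f' : ℝ → ℝ} (hf : ∀ ρ, 0 < ρ → HasDerivAt f (f' ρ) ρ)
    (hf' : ∀ ρ, 0 < ρ → HasDerivAt f' (f ρ - f' ρ / ρ) ρ) (ρ : ℝ) (hρ : 0 < ρ) :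
    HasDerivAt (fun ρ => f' ρ ^ 2 + f ρ ^ 2) (4 * f ρ * f' ρ - 2 * f' ρ ^ 2 / ρ) ρ := by
  refine (((hf' ρ hρ).fun_pow 2).fun_add ((hf ρ hρ).fun_pow 2)).congr_deriv ?_
  push_cast
  ring

lemma continuousOn_energy_aux {f f' : ℝ → ℝ} (hf : ContinuousOn f (Set.Ioi 0))
    (hf' : ContinuousOn f' (Set.Ioi 0)) :
    ContinuousOn (fun ρ => 4 * f ρ * f' ρ - 2 * f' ρ ^ 2 / ρ) (Set.Ioi 0) :=
  ((continuousOn_const.mul hf).mul hf').sub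
    ((continuousOn_const.mul (hf'.pow 2)).div continuousOn_id fun _ h => ne_of_gt h)

/-- The choice `B = 2f'²` is made because the radial equation gives `B' + B/ρ = E'` for the energy
`E = f'² + f²`. -/
lemma hasDerivAt_flux_aux {f f' : ℝ → ℝ}
    (hf' : ∀ ρ, 0 < ρ → HasDerivAt f' (f ρ - f' ρ / ρ) ρ) (ρ : ℝ) (hρ : 0 < ρ) :
    HasDerivAt (fun ρ => 2 * f' ρ ^ 2) (4 * f ρ * f' ρ - 4 * f' ρ ^ 2 / ρ) ρ := by
  refine (((hf' ρ hρ).fun_pow 2).const_mul 2).congr_deriv ?_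
  push_cast
  ring

lemma continuousOn_flux_aux {f f' : ℝ → ℝ} (hf : ContinuousOn f (Set.Ioi 0))
    (hf' : ContinuousOn f' (Set.Ioi 0)) :
    ContinuousOn (fun ρ => 4 * f ρ * f' ρ - 4 * f' ρ ^ 2 / ρ) (Set.Ioi 0) :=
  ((continuousOn_const.mul hf).mul hf').sub
    ((continuousOn_const.mul (hf'.pow 2)).div continuousOn_id fun _ h => ne_of_gt h)

/-- Opposite slopes have equal squares, so the energy is continuous across the kink. -/
lemma energy_match : S.inner' 2 ^ 2 + S.inner 2 ^ 2 = S.outer' 2 ^ 2 + S.outer 2 ^ 2 := by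
  rw [S.inner_eq_outer, show S.inner' 2 = S.d from S.inner_deriv,
    show S.outer' 2 = -S.d from S.outer_deriv, neg_sq]

lemma sum_stressTensor_mul (u : Plane → ℝ) (g : Plane → Plane) (x v : Plane) (j : Fin 2) :
    ∑ i : Fin 2, stressTensor u g x i j * v i =
      2 * g x j * (∑ i : Fin 2, g x i * v i) - (‖g x‖ ^ 2 + u x ^ 2) * v j := by
  fin_cases j <;> simp [stressTensor, Fin.sum_univ_two] <;> ring

/-- The factor `y_j/|y|` is homogeneous of degree zero, so its radial derivative vanishes. -/
lemma fderiv_mul_coord_div_norm {φ : Plane → ℝ} (hφ : ContDiff ℝ 1 φ) (j : Fin 2) {x : Plane}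
    (hx : x ≠ 0) : fderiv ℝ (fun y : Plane => φ y * (y j / ‖y‖)) x x =
      fderiv ℝ φ x x * (x j / ‖x‖) := by
  have hx' : ‖x‖ ≠ 0 := norm_ne_zero_iff.2 hx
  have hp : HasFDerivAt (fun y : Plane => y j) (EuclideanSpace.proj j : Plane →L[ℝ] ℝ) x :=
    (EuclideanSpace.proj j : Plane →L[ℝ] ℝ).hasFDerivAt
  have hinv : HasFDerivAt (fun y : Plane => ‖y‖⁻¹) ((-(‖x‖ ^ 2)⁻¹ / ‖x‖) • innerSL ℝ x) x :=
    hasFDerivAt_radial hx (hasDerivAt_inv hx')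
  have h := (hφ.differentiable (by norm_num) x).hasFDerivAt.fun_mul (hp.fun_mul hinv)
  simp only [← div_eq_mul_inv] at h
  rw [h.fderiv]
  simp
  field_simp
  ring

/-- The integrand of the stationarity condition, corrected by an exact derivative, is of the form
to which radial integration by parts applies. -/
lemma stationary_identity {f f' : ℝ → ℝ} {φ : Plane → ℝ} (hφ : ContDiff ℝ 1 φ) (j : Fin 2)
    {u : Plane → ℝ} {g w : Plane → Plane} {Q : ℝ} {x : Plane} (hx : x ≠ 0) (hu : u x = f ‖x‖)
    (hg : g x = (f' ‖x‖ / ‖x‖) • x) (hQ : Q = f' ‖x‖ ^ 2 + f ‖x‖ ^ 2)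
    (hw : w x = ((4 * f ‖x‖ * f' ‖x‖ - 2 * f' ‖x‖ ^ 2 / ‖x‖) / ‖x‖) • x) :
    ∑ i : Fin 2, stressTensor u g x i j * ∇ φ x i + (Q * ∇ φ x j + w x j * φ x) =
      (4 * f ‖x‖ * f' ‖x‖ - 4 * f' ‖x‖ ^ 2 / ‖x‖ + 2 * f' ‖x‖ ^ 2 / ‖x‖) * (φ x * (x j / ‖x‖)) +
        2 * f' ‖x‖ ^ 2 / ‖x‖ * fderiv ℝ (fun y : Plane => φ y * (y j / ‖y‖)) x x := by
  have hx' : ‖x‖ ≠ 0 := norm_ne_zero_iff.2 hx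
  have hn : ‖g x‖ ^ 2 = f' ‖x‖ ^ 2 := by
    rw [hg, norm_smul, mul_pow, Real.norm_eq_abs, sq_abs]
    field_simp
  have hs : ∑ i : Fin 2, g x i * ∇ φ x i = f' ‖x‖ / ‖x‖ * fderiv ℝ φ x x := by
    simp only [hg, PiLp.smul_apply, smul_eq_mul, mul_assoc, ← Finset.mul_sum, sum_gradient_mul]
  rw [sum_stressTensor_mul, hs, hn, hu, hQ, hw, hg, fderiv_mul_coord_div_norm hφ j hx]
  simp only [PiLp.smul_apply, smul_eq_mul]
  field_simp
  ring

/-- The energy is Lipschitz, so its part of the tensor can be integrated by parts over the whole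
annulus without a contribution from the circle. The part `2 ∂_i h ∂_j h` is radial with flux `2f'²`
tested against `φ x_j/|x|`, and its circle terms cancel because the slopes agree up to sign. -/
lemma isStationary_sol : IsStationary (annulus S.r S.R) S.sol (∇ S.sol) := by
  intro φ j
  obtain ⟨K, hK⟩ := S.exists_lipschitzWith_sol
  obtain ⟨C, hC⟩ := S.exists_bound_sol
  have hm := S.energy_match
  obtain ⟨L, hL⟩ : ∃ L, LipschitzWith L fun x : Plane => S.energy ‖x‖ :=
    exists_lipschitzWith_clampGlue S.r_pos S.r_lt.le S.lt_R.le
      (hasDerivAt_energy_aux S.hasDerivAt_inner S.hasDerivAt_inner')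
      (continuousOn_energy_aux S.continuousOn_inner S.continuousOn_inner')
      (hasDerivAt_energy_aux S.hasDerivAt_outer S.hasDerivAt_outer')
      (continuousOn_energy_aux S.continuousOn_outer S.continuousOn_outer')
  set Q : Plane → ℝ := fun x => S.energy ‖x‖ with hQ
  have hφ := S.contDiff_one φ
  have hi1 : IntegrableOn (fun x => ∑ i : Fin 2, stressTensor S.sol (∇ S.sol) x i j * ∇ φ x i)
      (annulus S.r S.R) := by
    refine integrable_finsetSum _ fun i _ => ?_
    refine integrableOn_annulus_of_bound (C := 2 * K * K + (K ^ 2 + C ^ 2)) ?_ (fun x => ?_)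
      (S.contDiff_gradient_apply φ i).continuous (S.hasCompactSupport_gradient_apply φ i)
    · simp only [stressTensor, Matrix.of_apply]
      refine ((measurable_const.mul (S.measurable_gradient_sol_apply i)).mul
        (S.measurable_gradient_sol_apply j)).sub ?_
      split_ifs
      · exact ((measurable_gradient S.sol).norm.pow_const 2).add
          (S.continuous_sol.measurable.pow_const 2)
      · exact measurable_const
    · have hgi : ∀ k, ‖∇ S.sol x k‖ ≤ K := fun k =>
        (PiLp.norm_apply_le (∇ S.sol x) k).trans (norm_gradient_le hK x)
      have hK0 : (0 : ℝ) ≤ K := K.2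
      have hg2 : ‖∇ S.sol x‖ ^ 2 ≤ K ^ 2 := by
        gcongr
        exact norm_gradient_le hK x
      have hs2 : S.sol x ^ 2 ≤ C ^ 2 := by
        rw [← sq_abs, ← Real.norm_eq_abs]
        gcongr
        exact hC x
      simp only [stressTensor, Matrix.of_apply]
      refine (norm_sub_le _ _).trans (add_le_add ?_ ?_)
      · rw [norm_mul, norm_mul, Real.norm_ofNat]
        gcongr
        · exact hgi i
        · exact hgi j
      · split_ifs
        · rw [Real.norm_of_nonneg (by positivity)]
          exact add_le_add hg2 hs2
        · rw [norm_zero]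
          positivity
  have hi2 : IntegrableOn (fun x => Q x * ∇ φ x j) (annulus S.r S.R) := by
    refine Integrable.integrableOn (Continuous.integrable_of_hasCompactSupport
      (hL.continuous.mul (S.contDiff_gradient_apply φ j).continuous)
      (S.hasCompactSupport_gradient_apply φ j).mul_left)
  have hi3 : IntegrableOn (fun x => ∇ Q x j * φ x) (annulus S.r S.R) :=
    integrableOn_annulus_of_bound
      ((EuclideanSpace.proj j : Plane →L[ℝ] ℝ).continuous.measurable.comp (measurable_gradient Q))
      (fun x => (PiLp.norm_apply_le (∇ Q x) j).trans (norm_gradient_le hL x))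
      φ.continuous φ.hasCompactSupport
  -- This null term is `∂_j(Qφ)`; adding it replaces `-Q ∂_j φ` in the stress tensor by `φ ∂_j Q`.
  have h1 : ∫ x in annulus S.r S.R, (Q x * ∇ φ x j + ∇ Q x j * φ x) = 0 := by
    rw [integral_add hi2 hi3, setIntegral_lipschitz_mul_gradient hL hφ φ.hasCompactSupport
      φ.tsupport_subset, neg_add_cancel]
  have hi4 : IntegrableOn (fun x => Q x * ∇ φ x j + ∇ Q x j * φ x) (annulus S.r S.R) :=
    hi2.add hi3
  have hi5 : IntegrableOn (fun x => ∑ i : Fin 2, stressTensor S.sol (∇ S.sol) x i j * ∇ φ x i +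
      (Q x * ∇ φ x j + ∇ Q x j * φ x)) (annulus S.r S.R) := hi1.add hi4
  have h2 : ∫ x in annulus S.r S.R,
      ∑ i : Fin 2, stressTensor S.sol (∇ S.sol) x i j * ∇ φ x i =
      ∫ x in annulus S.r S.R, (∑ i : Fin 2, stressTensor S.sol (∇ S.sol) x i j * ∇ φ x i +
        (Q x * ∇ φ x j + ∇ Q x j * φ x)) := by
    rw [integral_add hi1 hi4, h1, add_zero]
  have hne : ∀ {a b : ℝ} {x : Plane}, 0 < a → x ∈ annulus a b → x ≠ 0 := fun ha hx =>
    norm_pos_iff.1 (ha.trans (mem_annulus.1 hx).1)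
  have hφ' : ContDiffOn ℝ 1 (fun x : Plane => φ x * (x j / ‖x‖)) {0}ᶜ := by
    refine hφ.contDiffOn.mul (ContDiffOn.div ?_ (fun x hx => ?_) fun x hx => norm_ne_zero_iff.2 hx)
    · exact (EuclideanSpace.proj j : Plane →L[ℝ] ℝ).contDiff.contDiffOn
    · exact (contDiffAt_norm ℝ hx).contDiffWithinAt
  have h3 := S.integral_radial_by_parts_both (hasDerivAt_flux_aux S.hasDerivAt_inner')
    (continuousOn_flux_aux S.continuousOn_inner S.continuousOn_inner')
    (hasDerivAt_flux_aux S.hasDerivAt_outer')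
    (continuousOn_flux_aux S.continuousOn_outer S.continuousOn_outer') hφ'
    (fun x hx => by rw [S.eq_zero_of_notMem φ hx, zero_mul])
  rw [h2, setIntegral_annulus_split S.r_lt.le S.lt_R.le hi5]
  have hm' : 2 * S.inner' 2 ^ 2 - 2 * S.outer' 2 ^ 2 = 0 := by
    rw [S.inner_eq_outer] at hm
    linarith
  rw [hm', mul_zero, zero_mul] at h3
  rw [← h3]
  congr 1
  · refine setIntegral_congr_fun (annulus S.r 2).isOpen.measurableSet fun x hx => ?_
    have hx' := mem_annulus.1 hx
    exact stationary_identity hφ j (hne S.r_pos hx) (S.profile_inner hx'.1.le hx'.2.le)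
      (S.gradient_sol_inner hx) (clampGlue_left S.lt_R.le hx'.1.le hx'.2.le)
      (gradient_clampGlue_left S.r_pos S.lt_R.le
        (hasDerivAt_energy_aux S.hasDerivAt_inner S.hasDerivAt_inner') hx)
  · refine setIntegral_congr_fun (annulus 2 S.R).isOpen.measurableSet fun x hx => ?_
    have hx' := mem_annulus.1 hx
    exact stationary_identity hφ j (hne two_pos hx) (S.profile_outer hx'.1.le hx'.2.le)
      (S.gradient_sol_outer hx) (clampGlue_right hm S.r_lt.le hx'.1.le hx'.2.le)
      (gradient_clampGlue_right S.r_pos S.r_lt.le hm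
        (hasDerivAt_energy_aux S.hasDerivAt_outer S.hasDerivAt_outer') hx)

end GluingData

/-! ### Approximation by test functions -/

lemma tendsto_eLpNorm_two_zero {X E : Type*} [MeasurableSpace X] [NormedAddCommGroup E]
    {μ : Measure X} [IsFiniteMeasure μ] {G : ℕ → X → E} {C : ℝ}
    (hm : ∀ n, AEStronglyMeasurable (G n) μ) (hC : ∀ n, ∀ᵐ x ∂μ, ‖G n x‖ ≤ C)
    (h : ∀ᵐ x ∂μ, Tendsto (fun n => G n x) atTop (𝓝 0)) :
    Tendsto (fun n => eLpNorm (G n) 2 μ) atTop (𝓝 0) := by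
  have hcont : Continuous fun a : ℝ≥0∞ => a ^ (2 : ℝ) := ENNReal.continuous_rpow_const
  have h1 : Tendsto (fun n => ∫⁻ x, ‖G n x‖ₑ ^ (2 : ℝ) ∂μ) atTop (𝓝 (∫⁻ _, 0 ∂μ)) := by
    refine tendsto_lintegral_of_dominated_convergence' (fun _ => ENNReal.ofReal C ^ (2 : ℝ))
      (fun n => (hm n).enorm.pow_const _) (fun n => ?_) ?_ ?_
    · filter_upwards [hC n] with x hx
      refine ENNReal.rpow_le_rpow ?_ zero_le_two
      rw [← ofReal_norm]
      exact ENNReal.ofReal_le_ofReal hx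
    · rw [lintegral_const]
      exact ENNReal.mul_ne_top (ENNReal.rpow_ne_top_of_nonneg zero_le_two ENNReal.ofReal_ne_top)
        (measure_ne_top μ _)
    · filter_upwards [h] with x hx
      have h2 : Tendsto (fun n => ‖G n x‖ₑ ^ (2 : ℝ)) atTop (𝓝 (‖(0 : E)‖ₑ ^ (2 : ℝ))) :=
        (hcont.tendsto _).comp hx.enorm
      rwa [enorm_zero, ENNReal.zero_rpow_of_pos two_pos] at h2
  rw [lintegral_zero] at h1
  have h3 := ((ENNReal.continuous_rpow_const (y := 1 / 2)).tendsto 0).comp h1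
  rw [ENNReal.zero_rpow_of_pos (by norm_num)] at h3
  refine h3.congr fun n => ?_
  rw [eLpNorm_eq_lintegral_rpow_enorm_toReal (by norm_num) (by norm_num)]
  simp

/-- A smooth function which vanishes on `(-∞, 1]` and is the identity on `[2, ∞)`. -/
noncomputable def cutoffId (y : ℝ) : ℝ := y * Real.smoothTransition (y - 1)

lemma contDiff_cutoffId : ContDiff ℝ ∞ cutoffId :=
  contDiff_id.mul (Real.smoothTransition.contDiff.comp (contDiff_id.sub contDiff_const))

lemma cutoffId_of_le_one {y : ℝ} (hy : y ≤ 1) : cutoffId y = 0 := by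
  rw [cutoffId, Real.smoothTransition.zero_of_nonpos (by linarith), mul_zero]

lemma cutoffId_of_two_le {y : ℝ} (hy : 2 ≤ y) : cutoffId y = y := by
  rw [cutoffId, Real.smoothTransition.one_of_one_le (by linarith), mul_one]

lemma abs_cutoffId_le (y : ℝ) : |cutoffId y| ≤ |y| := by
  rw [cutoffId, abs_mul, abs_of_nonneg (Real.smoothTransition.nonneg _)]
  exact mul_le_of_le_one_right (abs_nonneg y) (Real.smoothTransition.le_one _)

lemma deriv_cutoffId_of_lt_one {y : ℝ} (hy : y < 1) : deriv cutoffId y = 0 := by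
  have h : cutoffId =ᶠ[𝓝 y] fun _ => 0 := by
    filter_upwards [Iio_mem_nhds hy] with z hz using cutoffId_of_le_one (le_of_lt hz)
  rw [h.deriv_eq, deriv_const]

lemma deriv_cutoffId_of_two_lt {y : ℝ} (hy : 2 < y) : deriv cutoffId y = 1 := by
  have h : cutoffId =ᶠ[𝓝 y] fun z => z := by
    filter_upwards [Ioi_mem_nhds hy] with z hz using cutoffId_of_two_le (le_of_lt hz)
  rw [h.deriv_eq, deriv_id'']

lemma exists_bound_deriv_cutoffId : ∃ C, ∀ y, |deriv cutoffId y| ≤ C := by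
  obtain ⟨C, hC⟩ := (isCompact_Icc (a := (1 : ℝ)) (b := 2)).exists_bound_of_continuousOn
    (contDiff_cutoffId.continuous_deriv (by norm_cast)).continuousOn
  refine ⟨max C 1, fun y => ?_⟩
  rcases lt_or_ge y 1 with h | h
  · rw [deriv_cutoffId_of_lt_one h, abs_zero]
    exact zero_le_one.trans (le_max_right _ _)
  rcases lt_or_ge 2 y with h' | h'
  · rw [deriv_cutoffId_of_two_lt h', abs_one]
    exact le_max_right _ _
  · exact (hC y ⟨h, h'⟩).trans (le_max_left _ _)

/-- A smooth approximation of `min a b`. -/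
noncomputable def smoothMin (ε a b : ℝ) : ℝ := (a + b) / 2 - √(((a - b) / 2) ^ 2 + ε ^ 2)

lemma smoothMin_le_min (ε a b : ℝ) : smoothMin ε a b ≤ min a b := by
  have h : |(a - b) / 2| ≤ √(((a - b) / 2) ^ 2 + ε ^ 2) :=
    Real.abs_le_sqrt (le_add_of_nonneg_right (sq_nonneg ε))
  have h1 := abs_le.1 h
  rw [smoothMin, le_min_iff]
  constructor <;> linarith [h1.1, h1.2, neg_abs_le ((a - b) / 2), le_abs_self ((a - b) / 2)]

lemma abs_smoothMin_le {ε : ℝ} (hε : 0 ≤ ε) (a b : ℝ) : |smoothMin ε a b| ≤ |a| + |b| + ε := by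
  have h : √(((a - b) / 2) ^ 2 + ε ^ 2) ≤ |(a - b) / 2| + ε := by
    refine Real.sqrt_le_iff.2 ⟨by positivity, ?_⟩
    have := sq_abs ((a - b) / 2)
    nlinarith [mul_nonneg (abs_nonneg ((a - b) / 2)) hε]
  have h0 := Real.sqrt_nonneg (((a - b) / 2) ^ 2 + ε ^ 2)
  have h1 : |(a - b) / 2| ≤ (|a| + |b|) / 2 := by
    rw [abs_div, abs_two]
    linarith [abs_sub a b]
  rw [smoothMin, abs_le]
  have h2 := neg_abs_le a
  have h3 := neg_abs_le b
  have h4 := le_abs_self a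
  have h5 := le_abs_self b
  constructor <;> linarith

lemma tendsto_sqrt_sq_add_sq (D : ℝ) :
    Tendsto (fun ε : ℝ => √(D ^ 2 + ε ^ 2)) (𝓝[>] 0) (𝓝 |D|) := by
  have h : Continuous fun ε : ℝ => √(D ^ 2 + ε ^ 2) := by fun_prop
  have := (h.tendsto 0).mono_left (nhdsWithin_le_nhds (s := Set.Ioi 0))
  simpa [Real.sqrt_sq_eq_abs] using this

namespace GluingData

variable (S : GluingData)

lemma sol_eq_zero_of_notMem {x : Plane} (hx : x ∉ annulus S.r S.R) : S.sol x = 0 := by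
  rw [mem_annulus, not_and_or, not_lt, not_lt] at hx
  exact hx.elim S.profile_of_le_r S.profile_of_R_le

/-- A smooth approximation of the profile on `(r, R)`. -/
noncomputable def smoothProfile (ε ρ : ℝ) : ℝ := smoothMin ε (S.inner ρ) (S.outer ρ)

/-- The derivative of `smoothProfile`. -/
noncomputable def smoothProfile' (ε ρ : ℝ) : ℝ :=
  (S.inner' ρ + S.outer' ρ) / 2 - ((S.inner ρ - S.outer ρ) / 2) *
    ((S.inner' ρ - S.outer' ρ) / 2) / √(((S.inner ρ - S.outer ρ) / 2) ^ 2 + ε ^ 2)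

/-- Approximation from below matters: truncating the smoothed profile at height `ε` then confines
the support to `h ≥ ε`. -/
lemma smoothProfile_le {ε ρ : ℝ} (h1 : S.r ≤ ρ) (h2 : ρ ≤ S.R) :
    S.smoothProfile ε ρ ≤ S.profile ρ := by
  rw [S.profile_eq_min h1 h2]
  exact smoothMin_le_min _ _ _

lemma hasDerivAt_smoothProfile {ε ρ : ℝ} (hε : 0 < ε) (hρ : 0 < ρ) :
    HasDerivAt (S.smoothProfile ε) (S.smoothProfile' ε ρ) ρ := by
  have h1 := S.hasDerivAt_inner ρ hρ
  have h2 := S.hasDerivAt_outer ρ hρ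
  have hne : ((S.inner ρ - S.outer ρ) / 2) ^ 2 + ε ^ 2 ≠ 0 := by positivity
  refine (((h1.fun_add h2).div_const 2).fun_sub
    ((((((h1.fun_sub h2).div_const 2).fun_pow 2).add_const (ε ^ 2)).sqrt hne))).congr_deriv ?_
  rw [smoothProfile']
  have : √(((S.inner ρ - S.outer ρ) / 2) ^ 2 + ε ^ 2) ≠ 0 := by positivity
  field_simp
  push_cast
  ring

lemma contDiffOn_smoothProfile {ε : ℝ} (hε : 0 < ε) :
    ContDiffOn ℝ ∞ (S.smoothProfile ε) (Set.Ioi 0) := by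
  have h1 : ContDiffOn ℝ ∞ S.inner (Set.Ioi 0) := contDiffOn_radialSol S.α S.β₁
  have h2 : ContDiffOn ℝ ∞ S.outer (Set.Ioi 0) := contDiffOn_radialSol S.α S.β₂
  exact ((h1.add h2).div_const 2).sub
    (((((h1.sub h2).div_const 2).pow 2).add contDiffOn_const).sqrt fun ρ _ => by positivity)

/-- The factor `D/√(D² + ε²)` is at most one in modulus, so the bound is uniform in `ε`, as
dominated convergence requires. -/
lemma abs_smoothProfile'_le {ε ρ : ℝ} (hε : 0 < ε) :
    |S.smoothProfile' ε ρ| ≤ |S.inner' ρ| + |S.outer' ρ| := by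
  set D := (S.inner ρ - S.outer ρ) / 2
  have hpos : 0 < √(D ^ 2 + ε ^ 2) := by positivity
  have h : |D * ((S.inner' ρ - S.outer' ρ) / 2) / √(D ^ 2 + ε ^ 2)| ≤
      |(S.inner' ρ - S.outer' ρ) / 2| := by
    rw [abs_div, abs_mul, abs_of_pos hpos, div_le_iff₀ hpos, mul_comm]
    exact mul_le_mul_of_nonneg_left (Real.abs_le_sqrt (le_add_of_nonneg_right (sq_nonneg ε)))
      (abs_nonneg _)
  refine (abs_sub _ _).trans ((add_le_add_right h _).trans ?_)
  rw [abs_div, abs_div, abs_two]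
  linarith [abs_add_le (S.inner' ρ) (S.outer' ρ), abs_sub (S.inner' ρ) (S.outer' ρ)]

lemma tendsto_smoothProfile {ρ : ℝ} (h1 : S.r ≤ ρ) (h2 : ρ ≤ S.R) :
    Tendsto (fun ε => S.smoothProfile ε ρ) (𝓝[>] 0) (𝓝 (S.profile ρ)) := by
  have h := (tendsto_const_nhds (x := (S.inner ρ + S.outer ρ) / 2)).sub
    (tendsto_sqrt_sq_add_sq ((S.inner ρ - S.outer ρ) / 2))
  have e : S.profile ρ = (S.inner ρ + S.outer ρ) / 2 - |(S.inner ρ - S.outer ρ) / 2| := by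
    rw [S.profile_eq_min h1 h2, abs_div, abs_two]
    rcases le_total (S.inner ρ) (S.outer ρ) with h | h
    · rw [min_eq_left h, abs_of_nonpos (sub_nonpos.2 h)]
      ring
    · rw [min_eq_right h, abs_of_nonneg (sub_nonneg.2 h)]
      ring
  rw [e]
  exact h

lemma tendsto_smoothProfile'_inner {ρ : ℝ} (h : 0 < ρ) (h2 : ρ < 2) :
    Tendsto (fun ε => S.smoothProfile' ε ρ) (𝓝[>] 0) (𝓝 (S.inner' ρ)) := by
  have hneg : (S.inner ρ - S.outer ρ) / 2 < 0 := by
    have hJ : besselQuot ρ < 0 := by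
      rw [← besselQuot_two]
      exact strictMonoOn_besselQuot h (Set.mem_Ioi.2 two_pos) h2
    have hc : 0 < (S.β₁ - S.β₂) * besselI ρ :=
      mul_pos (by linarith [S.β₁_pos, S.β₂_neg]) (besselI_pos ρ)
    linarith [S.inner_sub_outer ρ, mul_neg_of_pos_of_neg hc hJ]
  have ht := (tendsto_const_nhds (x := (S.inner' ρ + S.outer' ρ) / 2)).sub
    ((tendsto_const_nhds (x := (S.inner ρ - S.outer ρ) / 2 * ((S.inner' ρ - S.outer' ρ) / 2))).div
    (tendsto_sqrt_sq_add_sq ((S.inner ρ - S.outer ρ) / 2)) (abs_ne_zero.2 hneg.ne))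
  have e : S.inner' ρ = (S.inner' ρ + S.outer' ρ) / 2 - (S.inner ρ - S.outer ρ) / 2 *
      ((S.inner' ρ - S.outer' ρ) / 2) / |(S.inner ρ - S.outer ρ) / 2| := by
    rw [abs_of_neg hneg, div_neg, mul_div_cancel_left₀ _ hneg.ne]
    ring
  rw [e]
  exact ht

lemma tendsto_smoothProfile'_outer {ρ : ℝ} (h2 : 2 < ρ) :
    Tendsto (fun ε => S.smoothProfile' ε ρ) (𝓝[>] 0) (𝓝 (S.outer' ρ)) := by
  have hpos : 0 < (S.inner ρ - S.outer ρ) / 2 := by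
    have hJ : 0 < besselQuot ρ := by
      rw [← besselQuot_two]
      exact strictMonoOn_besselQuot (Set.mem_Ioi.2 two_pos) (Set.mem_Ioi.2 (two_pos.trans h2)) h2
    have hc : 0 < (S.β₁ - S.β₂) * besselI ρ :=
      mul_pos (by linarith [S.β₁_pos, S.β₂_neg]) (besselI_pos ρ)
    linarith [S.inner_sub_outer ρ, mul_pos hc hJ]
  have ht := (tendsto_const_nhds (x := (S.inner' ρ + S.outer' ρ) / 2)).sub
    ((tendsto_const_nhds (x := (S.inner ρ - S.outer ρ) / 2 * ((S.inner' ρ - S.outer' ρ) / 2))).div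
    (tendsto_sqrt_sq_add_sq ((S.inner ρ - S.outer ρ) / 2)) (abs_ne_zero.2 hpos.ne'))
  have e : S.outer' ρ = (S.inner' ρ + S.outer' ρ) / 2 - (S.inner ρ - S.outer ρ) / 2 *
      ((S.inner' ρ - S.outer' ρ) / 2) / |(S.inner ρ - S.outer ρ) / 2| := by
    rw [abs_of_pos hpos, mul_div_cancel_left₀ _ hpos.ne']
    ring
  rw [e]
  exact ht

open Classical in
/-- The test functions approximating the glued solution. -/
noncomputable def approx (ε : ℝ) (x : Plane) : ℝ :=
  if x ∈ annulus S.r S.R then ε * cutoffId (S.smoothProfile ε ‖x‖ / ε) else 0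

variable {S} in
lemma approx_of_mem {ε : ℝ} {x : Plane} (hx : x ∈ annulus S.r S.R) :
    S.approx ε x = ε * cutoffId (S.smoothProfile ε ‖x‖ / ε) := if_pos hx

lemma approx_eq_zero {ε : ℝ} (hε : 0 < ε) {x : Plane} (hx : S.sol x < ε) :
    S.approx ε x = 0 := by
  by_cases hm : x ∈ annulus S.r S.R
  · have h := mem_annulus.1 hm
    rw [approx_of_mem hm, cutoffId_of_le_one, mul_zero]
    rw [div_le_one hε]
    exact (S.smoothProfile_le h.1.le h.2.le).trans (le_of_lt hx)
  · exact if_neg hm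

/-- Inside the annulus this is a composition of smooth maps. At any other point `h = 0 < ε`, so by
continuity the approximation vanishes nearby. -/
lemma contDiff_approx {ε : ℝ} (hε : 0 < ε) : ContDiff ℝ ∞ (S.approx ε) := by
  refine contDiff_iff_contDiffAt.2 fun x => ?_
  by_cases hm : x ∈ annulus S.r S.R
  · have h0 : 0 < ‖x‖ := S.r_pos.trans (mem_annulus.1 hm).1
    have h1 : ContDiffAt ℝ ∞ (fun y : Plane => ε * cutoffId (S.smoothProfile ε ‖y‖ / ε)) x := by
      refine contDiffAt_const.mul (contDiff_cutoffId.contDiffAt.comp x (ContDiffAt.div_const ?_ ε))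
      exact ((S.contDiffOn_smoothProfile hε).contDiffAt (Ioi_mem_nhds h0)).comp x
        (contDiffAt_norm ℝ (norm_pos_iff.1 h0))
    refine h1.congr_of_eventuallyEq ?_
    filter_upwards [(annulus S.r S.R).isOpen.mem_nhds hm] with y hy using approx_of_mem hy
  · have h1 : S.approx ε =ᶠ[𝓝 x] fun _ => 0 := by
      have : ∀ᶠ y in 𝓝 x, S.sol y < ε :=
        S.continuous_sol.continuousAt.eventually_lt_const (by rwa [S.sol_eq_zero_of_notMem hm])
      filter_upwards [this] with y hy using S.approx_eq_zero hε hy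
    exact contDiffAt_const.congr_of_eventuallyEq h1

lemma tsupport_approx_subset {ε : ℝ} (hε : 0 < ε) :
    tsupport (S.approx ε) ⊆ {x | ε ≤ S.sol x} := by
  refine closure_minimal (fun x hx => ?_) (isClosed_le continuous_const S.continuous_sol)
  by_contra h
  exact hx (S.approx_eq_zero hε (not_le.1 h))

lemma tsupport_approx_subset_annulus {ε : ℝ} (hε : 0 < ε) :
    tsupport (S.approx ε) ⊆ annulus S.r S.R := fun _ hx => by
  by_contra h
  have h1 := S.tsupport_approx_subset hε hx
  rw [Set.mem_ofPred_eq, S.sol_eq_zero_of_notMem h] at h1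
  linarith

/-- `approx` as a bundled test function. -/
noncomputable def approxTest (ε : ℝ) (hε : 0 < ε) : 𝓓(annulus S.r S.R, ℝ) where
  toFun := S.approx ε
  contDiff' := S.contDiff_approx hε
  hasCompactSupport' := (isCompact_closedBall (0 : Plane) S.R).of_isClosed_subset
    (isClosed_tsupport _) fun _ hx => mem_closedBall_zero_iff.2
      (mem_annulus.1 (S.tsupport_approx_subset_annulus hε hx)).2.le
  tsupport_subset' := S.tsupport_approx_subset_annulus hε

lemma gradient_approx {ε : ℝ} (hε : 0 < ε) {x : Plane} (hx : x ∈ annulus S.r S.R) :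
    ∇ (S.approx ε) x = (deriv cutoffId (S.smoothProfile ε ‖x‖ / ε) *
      S.smoothProfile' ε ‖x‖ / ‖x‖) • x := by
  have h0 : 0 < ‖x‖ := S.r_pos.trans (mem_annulus.1 hx).1
  have hd : HasDerivAt (fun ρ => ε * cutoffId (S.smoothProfile ε ρ / ε))
      (deriv cutoffId (S.smoothProfile ε ‖x‖ / ε) * S.smoothProfile' ε ‖x‖) ‖x‖ := by
    have h1 : HasDerivAt cutoffId (deriv cutoffId (S.smoothProfile ε ‖x‖ / ε))
        (S.smoothProfile ε ‖x‖ / ε) :=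
      (contDiff_cutoffId.differentiable (by norm_cast) _).hasDerivAt
    refine ((h1.comp ‖x‖ ((S.hasDerivAt_smoothProfile hε h0).div_const ε)).const_mul ε).congr_deriv
      ?_
    field_simp
  rw [← gradient_radial (norm_pos_iff.1 h0) hd]
  have he : S.approx ε =ᶠ[𝓝 x] fun y : Plane => ε * cutoffId (S.smoothProfile ε ‖y‖ / ε) := by
    filter_upwards [(annulus S.r S.R).isOpen.mem_nhds hx] with y hy using approx_of_mem hy
  rw [gradient, gradient, he.fderiv_eq]

/-- At a fixed interior radius the smoothed profile tends to a positive limit while `2ε` tends to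
zero, so the truncation is eventually the identity there. -/
lemma eventually_two_lt {ρ : ℝ} (h1 : S.r < ρ) (h2 : ρ < S.R) :
    ∀ᶠ ε in 𝓝[>] 0, 2 < S.smoothProfile ε ρ / ε := by
  have h3 : Tendsto (fun ε : ℝ => 2 * ε) (𝓝[>] 0) (𝓝 0) :=
    (Continuous.tendsto' (by fun_prop) _ _ (by simp)).mono_left nhdsWithin_le_nhds
  filter_upwards [h3.eventually_lt (S.tendsto_smoothProfile h1.le h2.le) (S.profile_pos h1 h2),
    self_mem_nhdsWithin] with ε h4 h5
  rwa [lt_div_iff₀ h5]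

lemma tendsto_approx {x : Plane} (hx : x ∈ annulus S.r S.R) :
    Tendsto (fun ε => S.approx ε x) (𝓝[>] 0) (𝓝 (S.sol x)) := by
  have h := mem_annulus.1 hx
  refine (S.tendsto_smoothProfile h.1.le h.2.le).congr' ?_
  filter_upwards [S.eventually_two_lt h.1 h.2, self_mem_nhdsWithin] with ε h1 h2
  rw [approx_of_mem hx, cutoffId_of_two_le h1.le, mul_div_cancel₀ _ (ne_of_gt h2)]

lemma tendsto_gradient_approx {x : Plane} (hx : x ∈ annulus S.r S.R) (h2 : ‖x‖ ≠ 2) :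
    Tendsto (fun ε => ∇ (S.approx ε) x) (𝓝[>] 0) (𝓝 (∇ S.sol x)) := by
  have h := mem_annulus.1 hx
  have key : Tendsto (fun ε => (S.smoothProfile' ε ‖x‖ / ‖x‖) • x) (𝓝[>] 0) (𝓝 (∇ S.sol x)) := by
    rcases lt_or_gt_of_ne h2 with h3 | h3
    · rw [S.gradient_sol_inner (mem_annulus.2 ⟨h.1, h3⟩)]
      exact ((S.tendsto_smoothProfile'_inner (S.r_pos.trans h.1) h3).div_const _).smul_const x
    · rw [S.gradient_sol_outer (mem_annulus.2 ⟨h3, h.2⟩)]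
      exact ((S.tendsto_smoothProfile'_outer h3).div_const _).smul_const x
  refine key.congr' ?_
  filter_upwards [S.eventually_two_lt h.1 h.2, self_mem_nhdsWithin] with ε h4 h5
  rw [S.gradient_approx h5 hx, deriv_cutoffId_of_two_lt h4, one_mul]

lemma exists_bound_approx :
    ∃ C, ∀ ε, 0 < ε → ε ≤ 1 → ∀ x ∈ annulus S.r S.R, ‖S.approx ε x‖ ≤ C := by
  have hsub : Set.Icc S.r S.R ⊆ Set.Ioi 0 := fun ρ hρ => S.r_pos.trans_le hρ.1
  obtain ⟨C₁, h₁⟩ := isCompact_Icc.exists_bound_of_continuousOn (S.continuousOn_inner.mono hsub)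
  obtain ⟨C₂, h₂⟩ := isCompact_Icc.exists_bound_of_continuousOn (S.continuousOn_outer.mono hsub)
  refine ⟨C₁ + C₂ + 1, fun ε hε hε1 x hx => ?_⟩
  have hx' := mem_annulus.1 hx
  have hm : ‖x‖ ∈ Set.Icc S.r S.R := ⟨hx'.1.le, hx'.2.le⟩
  rw [approx_of_mem hx, norm_mul, Real.norm_of_nonneg hε.le]
  calc ε * ‖cutoffId (S.smoothProfile ε ‖x‖ / ε)‖ ≤ ε * |S.smoothProfile ε ‖x‖ / ε| :=
        mul_le_mul_of_nonneg_left (abs_cutoffId_le _) hε.le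
    _ = |S.smoothProfile ε ‖x‖| := by
        rw [abs_div, abs_of_pos hε, mul_div_cancel₀ _ hε.ne']
    _ ≤ |S.inner ‖x‖| + |S.outer ‖x‖| + ε := abs_smoothMin_le hε.le _ _
    _ ≤ C₁ + C₂ + 1 := add_le_add (add_le_add (h₁ _ hm) (h₂ _ hm)) hε1

lemma exists_bound_gradient_approx :
    ∃ C, ∀ ε, 0 < ε → ∀ x ∈ annulus S.r S.R, ‖∇ (S.approx ε) x‖ ≤ C := by
  have hsub : Set.Icc S.r S.R ⊆ Set.Ioi 0 := fun ρ hρ => S.r_pos.trans_le hρ.1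
  obtain ⟨C₁, h₁⟩ := isCompact_Icc.exists_bound_of_continuousOn (S.continuousOn_inner'.mono hsub)
  obtain ⟨C₂, h₂⟩ := isCompact_Icc.exists_bound_of_continuousOn (S.continuousOn_outer'.mono hsub)
  obtain ⟨C, hC⟩ := exists_bound_deriv_cutoffId
  refine ⟨C * (C₁ + C₂), fun ε hε x hx => ?_⟩
  have hx' := mem_annulus.1 hx
  have hm : ‖x‖ ∈ Set.Icc S.r S.R := ⟨hx'.1.le, hx'.2.le⟩
  have h0 : ‖x‖ ≠ 0 := (S.r_pos.trans hx'.1).ne'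
  rw [S.gradient_approx hε hx, norm_smul, norm_div, norm_norm, div_mul_cancel₀ _ h0, norm_mul]
  exact mul_le_mul (hC _) ((S.abs_smoothProfile'_le hε).trans (add_le_add (h₁ _ hm) (h₂ _ hm)))
    (norm_nonneg _) ((abs_nonneg _).trans (hC 0))

/-- Bounded convergence along `ε = 1/(n+1)`. Values converge throughout the annulus, gradients off
the circle of radius 2, which is a null set. -/
lemma isH10_sol : IsH10 (annulus S.r S.R) S.sol (∇ S.sol) := by
  have := isFiniteMeasure_restrict_annulus S.r S.R
  refine ⟨S.isH1_sol, ?_⟩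
  have hε0 : ∀ n : ℕ, (0 : ℝ) < 1 / (n + 1) := fun n => Nat.one_div_pos_of_nat
  have hε1 : ∀ n : ℕ, (1 : ℝ) / (n + 1) ≤ 1 := fun n => by
    rw [div_le_one (by positivity)]
    linarith [Nat.cast_nonneg (α := ℝ) n]
  have hε : Tendsto (fun n : ℕ => (1 : ℝ) / (n + 1)) atTop (𝓝[>] 0) :=
    tendsto_nhdsWithin_iff.2 ⟨tendsto_one_div_add_atTop_nhds_zero_nat, Eventually.of_forall hε0⟩
  have hΩ := ae_restrict_mem (μ := volume) (annulus S.r S.R).isOpen.measurableSet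
  obtain ⟨C₁, h₁⟩ := S.exists_bound_approx
  obtain ⟨C₂, h₂⟩ := S.exists_bound_sol
  obtain ⟨C₃, h₃⟩ := S.exists_bound_gradient_approx
  obtain ⟨C₄, h₄⟩ := S.exists_bound_gradient_sol
  refine ⟨fun n => S.approxTest _ (hε0 n), ?_, ?_⟩
  · refine tendsto_eLpNorm_two_zero (C := C₁ + C₂) (fun n => ?_) (fun n => ?_) ?_
    · exact ((S.approxTest _ (hε0 n)).continuous.sub S.continuous_sol).aestronglyMeasurable
    · filter_upwards [hΩ] with x hx
      exact (norm_sub_le _ _).trans (add_le_add (h₁ _ (hε0 n) (hε1 n) x hx) (h₂ x))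
    · filter_upwards [hΩ] with x hx
      exact tendsto_sub_nhds_zero_iff.2 ((S.tendsto_approx hx).comp hε)
  · refine tendsto_eLpNorm_two_zero (C := C₃ + C₄) (fun n => ?_) (fun n => ?_) ?_
    · exact ((measurable_gradient _).sub (measurable_gradient _)).aestronglyMeasurable
    · filter_upwards [hΩ] with x hx
      exact (norm_sub_le _ _).trans (add_le_add (h₃ _ (hε0 n) x hx) (h₄ x))
    · filter_upwards [hΩ, ae_restrict_of_ae (ae_norm_ne 2)] with x hx h2
      exact tendsto_sub_nhds_zero_iff.2 ((S.tendsto_gradient_approx hx h2).comp hε)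

end GluingData

end CircleExample
theorem mainTheorem10 :
    -- the two Dirichlet problems have exactly one solution each, and it is radial
    (∀ r : ℝ, 0 < r → r < 2 →
      (∃ u, CircleExample.IsDirichletSolution r 2 0 1 u) ∧
      (∀ u v, CircleExample.IsDirichletSolution r 2 0 1 u →
        CircleExample.IsDirichletSolution r 2 0 1 v →
          Set.EqOn u v (CircleExample.closedAnnulus r 2)) ∧
      (∀ u, CircleExample.IsDirichletSolution r 2 0 1 u →
        CircleExample.IsRadialOn (CircleExample.closedAnnulus r 2) u)) ∧
    (∀ R : ℝ, 2 < R →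
      (∃ u, CircleExample.IsDirichletSolution 2 R 1 0 u) ∧
      (∀ u v, CircleExample.IsDirichletSolution 2 R 1 0 u →
        CircleExample.IsDirichletSolution 2 R 1 0 v →
          Set.EqOn u v (CircleExample.closedAnnulus 2 R)) ∧
      (∀ u, CircleExample.IsDirichletSolution 2 R 1 0 u →
        CircleExample.IsRadialOn (CircleExample.closedAnnulus 2 R) u)) ∧
    -- for suitable radii, gluing them gives a nontrivial solution vanishing on the boundary
    (∃ r R : ℝ, 0 < r ∧ r < 2 ∧ 2 < R ∧
      CircleExample.IsSmoothBoundedDomain (CircleExample.annulus r R) ∧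
      (¬ ∃ x, StarConvex ℝ x (CircleExample.annulus r R : Set CircleExample.Plane)) ∧
      ∃ h₁ h₂ : CircleExample.Plane → ℝ,
        CircleExample.IsDirichletSolution r 2 0 1 h₁ ∧
        CircleExample.IsDirichletSolution 2 R 1 0 h₂ ∧
        ∃ d : ℝ, 0 < d ∧
          -- the one-sided radial derivatives at `|x| = 2` are `d` and `-d`
          (∀ e : CircleExample.Plane, ‖e‖ = 1 →
            HasDerivWithinAt (fun ρ : ℝ => h₁ (ρ • e)) d (Set.Iic 2) 2 ∧
            HasDerivWithinAt (fun ρ : ℝ => h₂ (ρ • e)) (-d) (Set.Ici 2) 2) ∧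
          -- `h = 0` on the boundary, pointwise
          ContinuousOn (CircleExample.glue h₁ h₂)
            (closure (CircleExample.annulus r R : Set CircleExample.Plane)) ∧
          (∀ x ∈ frontier (CircleExample.annulus r R : Set CircleExample.Plane),
            CircleExample.glue h₁ h₂ x = 0) ∧
          -- `h` is not the zero element of `H¹`
          (¬ CircleExample.glue h₁ h₂ =ᵐ[volume.restrict (CircleExample.annulus r R)] 0) ∧
          -- `-Δh + h = μ`, with `μ` a nonzero multiple of `H¹` on the circle `|x| = 2`
          CircleExample.SolvesHelmholtz (CircleExample.annulus r R)
            (CircleExample.glue h₁ h₂) (CircleExample.circleMeasure (2 * d)) ∧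
          IsFiniteMeasure (CircleExample.circleMeasure (2 * d)) ∧
          CircleExample.circleMeasure (2 * d) ≠ 0 ∧
          -- `h ∈ H¹` with zero trace, and `div T_h = 0`
          ∃ g : CircleExample.Plane → CircleExample.Plane,
            CircleExample.IsH10 (CircleExample.annulus r R) (CircleExample.glue h₁ h₂) g ∧
            CircleExample.IsStationary (CircleExample.annulus r R)
              (CircleExample.glue h₁ h₂) g) ∧
    -- without star-shapedness, the nonexistence result fails
    (¬ ∀ Ω : Opens CircleExample.Plane, CircleExample.IsSmoothBoundedDomain Ω →
      ∀ (h : CircleExample.Plane → ℝ) (g : CircleExample.Plane → CircleExample.Plane),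
        CircleExample.IsH10 Ω h g → CircleExample.IsStationary Ω h g →
          h =ᵐ[volume.restrict Ω] 0) := by
  obtain ⟨S⟩ := CircleExample.nonempty_gluingData
  refine ⟨fun r h0 h2 => CircleExample.dirichlet_existsUnique_radial h0 h2 0 1,
    fun R hR => CircleExample.dirichlet_existsUnique_radial two_pos hR 1 0,
    ⟨S.r, S.R, S.r_pos, S.r_lt, S.lt_R,
      CircleExample.isSmoothBoundedDomain_annulus S.r_pos S.r_lt_R,
      CircleExample.not_starConvex_annulus S.r_pos S.r_lt_R, S.sol, S.sol,
      S.isDirichletSolution_inner, S.isDirichletSolution_outer, S.d, S.d_pos,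
      fun e he => ⟨S.hasDerivWithinAt_sol_inner he, S.hasDerivWithinAt_sol_outer he⟩, ?_⟩, ?_⟩
  · rw [S.glue_sol]
    exact ⟨S.continuous_sol.continuousOn, fun x => S.sol_eq_zero_of_mem_frontier,
      S.not_ae_eq_zero, S.solvesHelmholtz_sol, CircleExample.isFiniteMeasure_circleMeasure _,
      CircleExample.circleMeasure_ne_zero (by linarith [S.d_pos]), _, S.isH10_sol,
      S.isStationary_sol⟩
  · exact fun h => S.not_ae_eq_zero (h _
      (CircleExample.isSmoothBoundedDomain_annulus S.r_pos S.r_lt_R) _ _ S.isH10_sol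
      S.isStationary_sol)
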